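/- A cubical $\omega$-category $\mathbf C$ (with connections, in the sense of Al-Agl, Brown and Steiner) consists of sets $\mathbf C_n$ of $n$-cells ($n\ge 0$), faces $\partial_i^\alpha:\mathbf C_n\to\mathbf C_{n-1}$ ($1\le i\le n$, $\alpha=\pm$), degeneracies $\epsilon_i:\mathbf C_n\to\mathbf C_{n+1}$ ($1\le i\le n+1$), connections $\Gamma_i^\alpha:\mathbf C_n\to\mathbf C_{n+1}$ ($1\le i\le n$), and partial compositions $\star_i$ on $\mathbf C_n$ ($1\le i\le n$), where $A\star_i B$ is defined exactly when $\partial_i^+A=\partial_i^-B$, subject to the usual axioms. For $i\neq j$ write $j_i=j$ if $j<i$ and $j_i=j-1$ if $j>i$. Let $1\le k\le n$ and $A\in\mathbf C_n$. - $A$ is *$R_k$-invertible* if there is $B\in\mathbf C_n$, called an $R_k$-inverse of $A$, such that $A\star_k B$ and $B\star_k A$ are defined, $A\star_k B=\epsilon_k\partial_k^-A$ and $B\star_k A=\epsilon_k\partial_k^+A$. - An *$n$-shell* is a family $(S_i^\alpha)_{1\le i\le n,\ \alpha=\pm}$ of $(n-1)$-cells with $\partial_{i_j}^\alpha S_j^\beta=\partial_{j_i}^\beta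 S_i^\alpha$ for all $i\ne j$; the shell of $A$ is $\bm\partial A=(\partial_i^\alpha A)$. If $S_k^+=T_k^-$, the shell $S\star_k T$ is given by $(S\star_k T)_k^-=S_k^-$, $(S\star_k T)_k^+=T_k^+$ and $(S\star_k T)_j^\alpha=S_j^\alpha\star_{k_j}T_j^\alpha$ for $j\ne k$; for $x\in\mathbf C_{n-1}$ the shell $\epsilon_k x$ is given by $(\epsilon_k x)_k^\beta=x$ and $(\epsilon_k x)_j^\beta=\epsilon_{k_j}\partial_{j_k}^\beta x$ for $j\neq k$. The cell $A$ *has an $R_k$-invertible shell* if there is an $n$-shell $T$ such that, with $S=\bm\partial A$, the composites $S\star_k T$ and $T\star_k S$ are defined, $S\star_k T=\epsilon_k S_k^-$ and $T\star_k S=\epsilon_k S_k^+$. - For $1\le i\le n-1$ put $\psi_iA=\Gamma_i^+\partial_{i+1}^-A\star_{i+1}A\star_{i+1}\Gamma_i^-\partial_{i+1}^+A$. The cell $A$ is *invertible* if $\psi_1\cdots\psi_{n-1}A$ is $R_1$-invertible, and *thin* if $\psi_1\cdots\psi_{n-1}A$ lies in the image of $\epsilon_1$. **Proposition.** Let $\mathbf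 C$ be a cubical $\omega$-category, $A\in\mathbf C_n$ and $1\le j\le n$. Then $A$ is $R_j$-invertible if and only if $A$ is invertible and has an $R_j$-invertible shell. Moreover, if $A$ is thin and $R_j$-invertible, then its $R_j$-inverse is thin. -/

import Mathlib

universe u

/-- The two possible signs `-` and `+` of a face or of a connection. -/
inductive Side where
  | minus : Side
  | plus : Side
  deriving DecidableEq

/-- The opposite sign. -/
def Side.opp : Side → Side
  | Side.minus => Side.plus
  | Side.plus => Side.minus

/-- A cubical set with connections.  Directions are numbered from `0`: the `n` directions
`1, …, n` of an `n`-cell are the elements `0, …, n - 1` of `Fin n`.  For `i : Fin n`, the directions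
`i` and `i + 1` of an `(n+1)`-cell are `i.castSucc` and `i.succ`. -/
structure CubicalSet where
  /-- The set of `n`-cells. -/
  cell : ℕ → Type u
  /-- The faces `∂_i^α`. -/
  face : ∀ {n : ℕ}, Fin (n + 1) → Side → cell (n + 1) → cell n
  /-- The degeneracies `ε_i`. -/
  eps : ∀ {n : ℕ}, Fin (n + 1) → cell n → cell (n + 1)
  /-- The connections `Γ_i^α`. -/
  conn : ∀ {n : ℕ}, Fin n → Side → cell n → cell (n + 1)
  /-- `∂_i^α ∂_j^β = ∂_{j-1}^β ∂_i^α` for `i < j`. -/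
  face_face : ∀ {n : ℕ} (i j : Fin (n + 1)) (α β : Side) (A : cell (n + 2)), i ≤ j →
    face i α (face j.succ β A) = face j β (face i.castSucc α A)
  /-- `∂_i^α ε_i = id`. -/
  face_eps_self : ∀ {n : ℕ} (i : Fin (n + 1)) (α : Side) (A : cell n), face i α (eps i A) = A
  /-- `∂_i^α ε_j = ε_{j-1} ∂_i^α` for `i < j`. -/
  face_eps_lt : ∀ {n : ℕ} (i j : Fin (n + 1)) (α : Side) (A : cell (n + 1)), i ≤ j →
    face i.castSucc α (eps j.succ A) = eps j (face i α A)
  /-- `∂_i^α ε_j = ε_j ∂_{i-1}^α` for `i > j`. -/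
  face_eps_gt : ∀ {n : ℕ} (i j : Fin (n + 1)) (α : Side) (A : cell (n + 1)), j ≤ i →
    face i.succ α (eps j.castSucc A) = eps j (face i α A)
  /-- `∂_i^α Γ_i^α = id`. -/
  face_conn_same : ∀ {n : ℕ} (i : Fin n) (α : Side) (A : cell n),
    face i.castSucc α (conn i α A) = A
  /-- `∂_{i+1}^α Γ_i^α = id`. -/
  face_succ_conn_same : ∀ {n : ℕ} (i : Fin n) (α : Side) (A : cell n),
    face i.succ α (conn i α A) = A
  /-- `∂_i^α Γ_i^{-α} = ε_i ∂_i^α`. -/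
  face_conn_opp : ∀ {n : ℕ} (i : Fin (n + 1)) (α : Side) (A : cell (n + 1)),
    face i.castSucc α (conn i α.opp A) = eps i (face i α A)
  /-- `∂_{i+1}^α Γ_i^{-α} = ε_i ∂_i^α`. -/
  face_succ_conn_opp : ∀ {n : ℕ} (i : Fin (n + 1)) (α : Side) (A : cell (n + 1)),
    face i.succ α (conn i α.opp A) = eps i (face i α A)
  /-- `∂_i^α Γ_j^β = Γ_{j-1}^β ∂_i^α` for `i < j`. -/
  face_conn_lt : ∀ {n : ℕ} (i : Fin (n + 1)) (j : Fin n) (α β : Side) (A : cell (n + 1)),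
    i ≤ j.castSucc → face i.castSucc α (conn j.succ β A) = conn j β (face i α A)
  /-- `∂_i^α Γ_j^β = Γ_j^β ∂_{i-1}^α` for `i > j + 1`. -/
  face_conn_gt : ∀ {n : ℕ} (i : Fin (n + 1)) (j : Fin n) (α β : Side) (A : cell (n + 1)),
    j.castSucc < i → face i.succ α (conn j.castSucc β A) = conn j β (face i α A)
  /-- `ε_i ε_j = ε_{j+1} ε_i` for `i ≤ j`. -/
  eps_eps : ∀ {n : ℕ} (i j : Fin (n + 1)) (A : cell n), i ≤ j →
    eps i.castSucc (eps j A) = eps j.succ (eps i A)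
  /-- `Γ_i^α Γ_j^β = Γ_{j+1}^β Γ_i^α` for `i < j`. -/
  conn_conn_lt : ∀ {n : ℕ} (i j : Fin n) (α β : Side) (A : cell n), i < j →
    conn i.castSucc α (conn j β A) = conn j.succ β (conn i α A)
  /-- `Γ_{i+1}^α Γ_i^α = Γ_i^α Γ_i^α`. -/
  conn_conn_self : ∀ {n : ℕ} (i : Fin n) (α : Side) (A : cell n),
    conn i.succ α (conn i α A) = conn i.castSucc α (conn i α A)
  /-- `Γ_i^α ε_i = ε_i ε_i`. -/
  conn_eps_self : ∀ {n : ℕ} (i : Fin (n + 1)) (α : Side) (A : cell n),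
    conn i α (eps i A) = eps i.castSucc (eps i A)
  /-- `Γ_i^α ε_j = ε_{j+1} Γ_i^α` for `i < j`. -/
  conn_eps_lt : ∀ {n : ℕ} (i : Fin n) (j : Fin (n + 1)) (α : Side) (A : cell n),
    i.castSucc < j → conn i.castSucc α (eps j A) = eps j.succ (conn i α A)
  /-- `Γ_i^α ε_j = ε_j Γ_{i-1}^α` for `i > j`. -/
  conn_eps_gt : ∀ {n : ℕ} (i : Fin n) (j : Fin (n + 1)) (α : Side) (A : cell n),
    j ≤ i.castSucc → conn i.succ α (eps j A) = eps j.castSucc (conn i α A)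

/-- A cubical `ω`-category (with connections).  The composite `A ⋆_i B` is defined exactly when
`∂_i^+ A = ∂_i^- B`; accordingly `comp` takes a proof of this equality.  An axiom that quantifies
over such proofs holds whenever the composites that occur in it are defined. -/
structure CubicalOmegaCategory extends CubicalSet.{u} where
  /-- The composition `A ⋆_i B`. -/
  comp : ∀ {n : ℕ} (i : Fin (n + 1)) (A B : cell (n + 1)),
    face i Side.plus A = face i Side.minus B → cell (n + 1)
  /-- `∂_i^- (A ⋆_i B) = ∂_i^- A`. -/
  face_minus_comp : ∀ {n : ℕ} (i : Fin (n + 1)) (A B : cell (n + 1)) (h),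
    face i Side.minus (comp i A B h) = face i Side.minus A
  /-- `∂_i^+ (A ⋆_i B) = ∂_i^+ B`. -/
  face_plus_comp : ∀ {n : ℕ} (i : Fin (n + 1)) (A B : cell (n + 1)) (h),
    face i Side.plus (comp i A B h) = face i Side.plus B
  /-- `∂_i^α (A ⋆_j B) = ∂_i^α A ⋆_{j-1} ∂_i^α B` for `i < j`. -/
  face_comp_lt : ∀ {n : ℕ} (i j : Fin (n + 1)) (α : Side) (A B : cell (n + 2)) (h h'), i ≤ j →
    face i.castSucc α (comp j.succ A B h) =
      comp j (face i.castSucc α A) (face i.castSucc α B) h'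
  /-- `∂_i^α (A ⋆_j B) = ∂_i^α A ⋆_j ∂_i^α B` for `i > j`. -/
  face_comp_gt : ∀ {n : ℕ} (i j : Fin (n + 1)) (α : Side) (A B : cell (n + 2)) (h h'), j ≤ i →
    face i.succ α (comp j.castSucc A B h) = comp j (face i.succ α A) (face i.succ α B) h'
  /-- `(A ⋆_i B) ⋆_j (C ⋆_i D) = (A ⋆_j C) ⋆_i (B ⋆_j D)` for `i ≠ j`. -/
  exchange : ∀ {n : ℕ} (i j : Fin (n + 1)) (A B C D : cell (n + 1)) (h₁ h₂ h₃ h₄ h₅ h₆), i ≠ j →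
    comp j (comp i A B h₁) (comp i C D h₂) h₃ = comp i (comp j A C h₄) (comp j B D h₅) h₆
  /-- `A ⋆_i (B ⋆_i C) = (A ⋆_i B) ⋆_i C`. -/
  assoc : ∀ {n : ℕ} (i : Fin (n + 1)) (A B C : cell (n + 1)) (h₁ h₂ h₃ h₄),
    comp i A (comp i B C h₁) h₂ = comp i (comp i A B h₃) C h₄
  /-- `A ⋆_i ε_i ∂_i^+ A = A`. -/
  comp_eps : ∀ {n : ℕ} (i : Fin (n + 1)) (A : cell (n + 1)) (h),
    comp i A (eps i (face i Side.plus A)) h = A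
  /-- `ε_i ∂_i^- A ⋆_i A = A`. -/
  eps_comp : ∀ {n : ℕ} (i : Fin (n + 1)) (A : cell (n + 1)) (h),
    comp i (eps i (face i Side.minus A)) A h = A
  /-- `ε_i (A ⋆_j B) = ε_i A ⋆_{j+1} ε_i B` for `i ≤ j`. -/
  eps_comp_le : ∀ {n : ℕ} (i j : Fin (n + 1)) (A B : cell (n + 1)) (h h'), i ≤ j →
    eps i.castSucc (comp j A B h) = comp j.succ (eps i.castSucc A) (eps i.castSucc B) h'
  /-- `ε_i (A ⋆_j B) = ε_i A ⋆_j ε_i B` for `i > j`. -/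
  eps_comp_gt : ∀ {n : ℕ} (i j : Fin (n + 1)) (A B : cell (n + 1)) (h h'), j ≤ i →
    eps i.succ (comp j A B h) = comp j.castSucc (eps i.succ A) (eps i.succ B) h'
  /-- `Γ_i^+ A ⋆_i Γ_i^- A = ε_{i+1} A`. -/
  conn_comp_conn : ∀ {n : ℕ} (i : Fin (n + 1)) (A : cell (n + 1)) (h),
    comp i.castSucc (conn i Side.plus A) (conn i Side.minus A) h = eps i.succ A
  /-- `Γ_i^+ A ⋆_{i+1} Γ_i^- A = ε_i A`. -/
  conn_comp_succ_conn : ∀ {n : ℕ} (i : Fin (n + 1)) (A : cell (n + 1)) (h),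
    comp i.succ (conn i Side.plus A) (conn i Side.minus A) h = eps i.castSucc A
  /-- `Γ_i^α (A ⋆_j B) = Γ_i^α A ⋆_{j+1} Γ_i^α B` for `i < j`. -/
  conn_comp_lt : ∀ {n : ℕ} (i j : Fin (n + 1)) (α : Side) (A B : cell (n + 1)) (h h'), i < j →
    conn i α (comp j A B h) = comp j.succ (conn i α A) (conn i α B) h'
  /-- `Γ_i^α (A ⋆_j B) = Γ_i^α A ⋆_j Γ_i^α B` for `i > j`. -/
  conn_comp_gt : ∀ {n : ℕ} (i j : Fin (n + 1)) (α : Side) (A B : cell (n + 1)) (h h'), j < i →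
    conn i α (comp j A B h) = comp j.castSucc (conn i α A) (conn i α B) h'
  /-- `Γ_i^- (A ⋆_i B) = (Γ_i^- A ⋆_i ε_{i+1} B) ⋆_{i+1} (ε_i B ⋆_i Γ_i^- B)`. -/
  conn_minus_comp : ∀ {n : ℕ} (i : Fin (n + 1)) (A B : cell (n + 1)) (h h₁ h₂ h₃),
    conn i Side.minus (comp i A B h) =
      comp i.succ
        (comp i.castSucc (conn i Side.minus A) (eps i.succ B) h₁)
        (comp i.castSucc (eps i.castSucc B) (conn i Side.minus B) h₂) h₃
  /-- `Γ_i^+ (A ⋆_i B) = (Γ_i^+ A ⋆_i ε_i A) ⋆_{i+1} (ε_{i+1} A ⋆_i Γ_i^+ B)`. -/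
  conn_plus_comp : ∀ {n : ℕ} (i : Fin (n + 1)) (A B : cell (n + 1)) (h h₁ h₂ h₃),
    conn i Side.plus (comp i A B h) =
      comp i.succ
        (comp i.castSucc (conn i Side.plus A) (eps i.castSucc A) h₁)
        (comp i.castSucc (eps i.succ A) (conn i Side.plus B) h₂) h₃

/-- The renumbering `j_i` of a direction `j ≠ i` after the direction `i` has been removed:
`j_i = j` if `j < i`, and `j_i = j - 1` if `j > i`.  (The value at `j = i` is never used.) -/
def lowerIndex {n : ℕ} (i j : Fin (n + 2)) : Fin (n + 1) :=
  ⟨if j.1 < i.1 then j.1 else j.1 - 1, by split <;> omega⟩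

theorem lowerIndex_castSucc_succ {n : ℕ} {i j : Fin (n + 1)} (h : i ≤ j) :
    lowerIndex i.castSucc j.succ = j := by
  have := Fin.le_def.1 h
  ext; simp [lowerIndex]; omega

theorem lowerIndex_succ_castSucc {n : ℕ} {i j : Fin (n + 1)} (h : i ≤ j) :
    lowerIndex j.succ i.castSucc = i := by
  have := Fin.le_def.1 h
  ext; simp [lowerIndex]; omega

/-- Two distinct directions are of the form `i` and `j + 1` with `i ≤ j`, in one of the orders. -/
theorem exists_castSucc_succ {n : ℕ} (a b : Fin (n + 2)) (h : a < b) :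
    ∃ i j : Fin (n + 1), i ≤ j ∧ a = i.castSucc ∧ b = j.succ := by
  have := Fin.lt_def.1 h
  refine ⟨⟨a.1, by omega⟩, ⟨b.1 - 1, by omega⟩, ?_, ?_, ?_⟩
  · simp only [Fin.mk_le_mk]; omega
  · ext; simp
  · ext; simp; omega

theorem lowerIndex_ne {n : ℕ} {a b c : Fin (n + 2)} (hab : a ≠ b) (hcb : c ≠ b) (hac : a ≠ c) :
    lowerIndex b a ≠ lowerIndex b c := by
  simp only [lowerIndex, ne_eq, Fin.mk.injEq]
  split_ifs <;> omega

theorem lowerIndex_lowerIndex {n : ℕ} {i j k : Fin (n + 3)} (hij : i ≠ j) (hi : i ≠ k)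
    (hj : j ≠ k) : lowerIndex (lowerIndex j i) (lowerIndex j k) =
      lowerIndex (lowerIndex i j) (lowerIndex i k) := by
  simp only [lowerIndex, Fin.mk.injEq]
  split_ifs <;> omega

namespace CubicalSet

variable (X : CubicalSet.{u})

theorem face_lower {n : ℕ} (i j : Fin (n + 2)) (h : i ≠ j) (α β : Side) (A : X.cell (n + 2)) :
    X.face (lowerIndex j i) α (X.face j β A) = X.face (lowerIndex i j) β (X.face i α A) := by
  rcases lt_or_gt_of_ne h with h | h
  · obtain ⟨a, b, hab, rfl, rfl⟩ := exists_castSucc_succ _ _ h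
    rw [lowerIndex_castSucc_succ hab, lowerIndex_succ_castSucc hab]
    exact X.face_face a b α β A hab
  · obtain ⟨a, b, hab, rfl, rfl⟩ := exists_castSucc_succ _ _ h
    rw [lowerIndex_castSucc_succ hab, lowerIndex_succ_castSucc hab]
    exact (X.face_face a b β α A hab).symm

/-- A family `(F_i^α)` of `m`-cells, `1 ≤ i ≤ m + 1`, is compatible if
`∂_{i_j}^α F_j^β = ∂_{j_i}^β F_i^α` for all `i ≠ j` (no condition if `m = 0`). -/
def ShellCompat : (m : ℕ) → (Fin (m + 1) → Side → X.cell m) → Prop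
  | 0, _ => True
  | _ + 1, F => ∀ i j, i ≠ j → ∀ α β,
      X.face (lowerIndex j i) α (F j β) = X.face (lowerIndex i j) β (F i α)

/-- The `(m+1)`-cells of `□_m X`: compatible families of `m`-cells. -/
@[ext]
structure Shell (m : ℕ) where
  /-- The faces of the shell. -/
  face : Fin (m + 1) → Side → X.cell m
  /-- The faces match. -/
  compat : X.ShellCompat m face

/-- The shell `(∂_i^α A)` of a cell `A`. -/
def shell : {m : ℕ} → X.cell (m + 1) → X.Shell m
  | 0, A => ⟨fun i α => X.face i α A, trivial⟩
  | _ + 1, A => ⟨fun i α => X.face i α A, fun i j h α β => X.face_lower i j h α β A⟩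

/-- The faces of the degenerate shell `ε_i x`: `(ε_i x)_i^β = x`, and
`(ε_i x)_j^β = ε_{i_j} ∂_{j_i}^β x` for `j ≠ i`. -/
def epsFace : (m : ℕ) → Fin (m + 1) → X.cell m → Fin (m + 1) → Side → X.cell m
  | 0, _, x => fun _ _ => x
  | _ + 1, i, x => fun j β =>
      if j = i then x else X.eps (lowerIndex j i) (X.face (lowerIndex i j) β x)

theorem epsFace_eq {m : ℕ} (i : Fin (m + 2)) (x : X.cell (m + 1)) (j : Fin (m + 2)) (β : Side) :
    X.epsFace (m + 1) i x j β = X.face j β (X.eps i x) := by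
  by_cases hj : j = i
  · subst hj
    simp [epsFace, X.face_eps_self]
  · simp only [epsFace, if_neg hj]
    rcases lt_or_gt_of_ne hj with h | h
    · obtain ⟨a, b, hab, rfl, rfl⟩ := exists_castSucc_succ _ _ h
      rw [lowerIndex_castSucc_succ hab, lowerIndex_succ_castSucc hab,
        X.face_eps_lt a b β x hab]
    · obtain ⟨a, b, hab, rfl, rfl⟩ := exists_castSucc_succ _ _ h
      rw [lowerIndex_castSucc_succ hab, lowerIndex_succ_castSucc hab,
        X.face_eps_gt b a β x hab]

/-- The degeneracy `ε_i` from `m`-cells to `(m+1)`-cells of `□_m X`. -/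
def shellEps : {m : ℕ} → Fin (m + 1) → X.cell m → X.Shell m
  | 0, i, x => ⟨X.epsFace 0 i x, trivial⟩
  | m + 1, i, x => ⟨X.epsFace (m + 1) i x, fun a b h α β => by
      rw [epsFace_eq, epsFace_eq]; exact X.face_lower a b h α β _⟩

end CubicalSet

namespace CubicalOmegaCategory

variable (C : CubicalOmegaCategory.{u})

/-- The faces of the composite `S ⋆_k T` of two shells with `S_k^+ = T_k^-`:
`(S ⋆_k T)_k^- = S_k^-`, `(S ⋆_k T)_k^+ = T_k^+`, and
`(S ⋆_k T)_j^α = S_j^α ⋆_{k_j} T_j^α` for `j ≠ k`. -/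
def shellCompFace : {m : ℕ} → (k : Fin (m + 1)) → (S T : C.Shell m) →
    S.face k Side.plus = T.face k Side.minus → Fin (m + 1) → Side → C.cell m
  | 0, k, S, T, _ => fun _ α =>
      match α with
      | Side.minus => S.face k Side.minus
      | Side.plus => T.face k Side.plus
  | _ + 1, k, S, T, h => fun j α =>
      if hj : j = k then
        match α with
        | Side.minus => S.face k Side.minus
        | Side.plus => T.face k Side.plus
      else
        C.comp (lowerIndex j k) (S.face j α) (T.face j α) (by
          rw [S.compat k j (Ne.symm hj) Side.plus α, T.compat k j (Ne.symm hj) Side.minus α, h])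

theorem comp_congr {n : ℕ} {i i' : Fin (n + 1)} {A A' B B' : C.cell (n + 1)} (hi : i = i')
    (hA : A = A') (hB : B = B') (h h') : C.comp i A B h = C.comp i' A' B' h' := by
  subst hi hA hB; rfl

theorem face_comp {n : ℕ} (i j : Fin (n + 2)) (hij : i ≠ j) (α : Side) (A B : C.cell (n + 2))
    (h h') : C.face i α (C.comp j A B h) =
      C.comp (lowerIndex i j) (C.face i α A) (C.face i α B) h' := by
  rcases lt_or_gt_of_ne hij with hl | hl
  · obtain ⟨a, b, hab, rfl, rfl⟩ := exists_castSucc_succ _ _ hl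
    rw [C.face_comp_lt a b α A B h
      (by simpa [lowerIndex_castSucc_succ hab] using h') hab]
    exact C.comp_congr (lowerIndex_castSucc_succ hab).symm rfl rfl _ _
  · obtain ⟨a, b, hab, rfl, rfl⟩ := exists_castSucc_succ _ _ hl
    rw [C.face_comp_gt b a α A B h
      (by simpa [lowerIndex_succ_castSucc hab] using h') hab]
    exact C.comp_congr (lowerIndex_succ_castSucc hab).symm rfl rfl _ _

theorem shellCompFace_compat {m : ℕ} (k : Fin (m + 1)) (S T : C.Shell m)
    (h : S.face k Side.plus = T.face k Side.minus) :
    C.ShellCompat m (C.shellCompFace k S T h) := by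
  match m, k, S, T, h with
  | 0, _, _, _, _ => trivial
  | m + 1, k, S, T, h =>
    have key : ∀ j, j ≠ k → ∀ α β,
        C.face (lowerIndex j k) α (C.shellCompFace k S T h j β) =
          C.face (lowerIndex k j) β (C.shellCompFace k S T h k α) := by
      intro j hj α β
      have h₁ := S.compat k j (Ne.symm hj) Side.minus β
      have h₂ := T.compat k j (Ne.symm hj) Side.plus β
      cases α
      · simp only [shellCompFace, dif_neg hj, dif_pos, C.face_minus_comp, h₁]
      · simp only [shellCompFace, dif_neg hj, dif_pos, C.face_plus_comp, h₂]
    intro i j hij α β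
    by_cases hi : i = k
    · subst hi; exact key j (Ne.symm hij) α β
    by_cases hj : j = k
    · subst hj; exact (key i hij β α).symm
    match m, k, S, T, h, i, j, hij, hi, hj with
    | 0, k, S, T, h, i, j, hij, hi, hj => omega
    | m + 1, k, S, T, h, i, j, hij, hi, hj =>
      simp only [shellCompFace, dif_neg hi, dif_neg hj]
      have cond : ∀ a b, a ≠ k → b ≠ k → a ≠ b → ∀ γ δ,
          C.face (lowerIndex (lowerIndex a b) (lowerIndex a k)) Side.plus
              (C.face (lowerIndex a b) γ (S.face a δ)) =
            C.face (lowerIndex (lowerIndex a b) (lowerIndex a k)) Side.minus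
              (C.face (lowerIndex a b) γ (T.face a δ)) := by
        intro a b ha hb hab γ δ
        have n₁ := lowerIndex_ne (Ne.symm ha) (Ne.symm hab) (Ne.symm hb)
        rw [C.face_lower _ _ n₁, C.face_lower _ _ n₁, S.compat k a (Ne.symm ha),
          T.compat k a (Ne.symm ha), h]
      rw [C.face_comp _ _ (lowerIndex_ne hij (Ne.symm hj) hi) α _ _ _ (cond j i hj hi (Ne.symm hij) α β),
        C.face_comp _ _ (lowerIndex_ne (Ne.symm hij) (Ne.symm hi) hj) β _ _ _ (cond i j hi hj hij β α)]
      exact C.comp_congr (lowerIndex_lowerIndex hij hi hj) (S.compat i j hij α β)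
        (T.compat i j hij α β) _ _

/-- The composition `S ⋆_k T` of two `(m+1)`-cells of `□_m C` with `S_k^+ = T_k^-`. -/
def shellComp {m : ℕ} (k : Fin (m + 1)) (S T : C.Shell m)
    (h : S.face k Side.plus = T.face k Side.minus) : C.Shell m :=
  ⟨C.shellCompFace k S T h, C.shellCompFace_compat k S T h⟩

/-- `B` is an `R_k`-inverse of `A`: `A ⋆_k B = ε_k ∂_k^- A` and `B ⋆_k A = ε_k ∂_k^+ A`, both
composites being defined. -/
def IsRInverse {n : ℕ} (k : Fin (n + 1)) (A B : C.cell (n + 1)) : Prop :=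
  ∃ (h₁ : C.face k Side.plus A = C.face k Side.minus B)
    (h₂ : C.face k Side.plus B = C.face k Side.minus A),
    C.comp k A B h₁ = C.eps k (C.face k Side.minus A) ∧
      C.comp k B A h₂ = C.eps k (C.face k Side.plus A)

/-- `A` is `R_k`-invertible. -/
def IsRInvertible {n : ℕ} (k : Fin (n + 1)) (A : C.cell (n + 1)) : Prop :=
  ∃ B, C.IsRInverse k A B

/-- `T` is an `R_k`-inverse of `S` in `□_m C`. -/
def IsShellRInverse {m : ℕ} (k : Fin (m + 1)) (S T : C.Shell m) : Prop :=
  ∃ (h₁ : S.face k Side.plus = T.face k Side.minus)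
    (h₂ : T.face k Side.plus = S.face k Side.minus),
    C.shellComp k S T h₁ = C.shellEps k (S.face k Side.minus) ∧
      C.shellComp k T S h₂ = C.shellEps k (S.face k Side.plus)

/-- `A` has an `R_k`-invertible shell: the shell of `A` is `R_k`-invertible in `□_m C`. -/
def HasRInvertibleShell {m : ℕ} (k : Fin (m + 1)) (A : C.cell (m + 1)) : Prop :=
  ∃ T, C.IsShellRInverse k (C.shell A) T

/-- The folding operation `ψ_i A = Γ_i^+ ∂_{i+1}^- A ⋆_{i+1} A ⋆_{i+1} Γ_i^- ∂_{i+1}^+ A` on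
`(m+1)`-cells, where `i` is one of the `m` directions `1, …, m`. -/
def psi {m : ℕ} (i : Fin m) (A : C.cell (m + 1)) : C.cell (m + 1) :=
  C.comp i.succ
    (C.comp i.succ (C.conn i Side.plus (C.face i.succ Side.minus A)) A
      (C.face_succ_conn_same i Side.plus _))
    (C.conn i Side.minus (C.face i.succ Side.plus A))
    ((C.face_plus_comp i.succ _ _ _).trans (C.face_succ_conn_same i Side.minus _).symm)

/-- For an `n`-cell `A` with `n = m + 1`, the cell `ψ_1 (ψ_2 (⋯ (ψ_{n-1} A)))`. -/
def psiAll {m : ℕ} (A : C.cell (m + 1)) : C.cell (m + 1) :=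
  Fin.foldr m (fun i B => C.psi i B) A

/-- `A` is invertible: `ψ_1 ⋯ ψ_{n-1} A` is `R_1`-invertible. -/
def IsInvertible {m : ℕ} (A : C.cell (m + 1)) : Prop :=
  C.IsRInvertible 0 (C.psiAll A)

/-- `A` is thin: `ψ_1 ⋯ ψ_{n-1} A` is in the image of `ε_1`. -/
def IsThin {m : ℕ} (A : C.cell (m + 1)) : Prop :=
  ∃ x : C.cell m, C.psiAll A = C.eps 0 x

end CubicalOmegaCategory

/-! In two consecutive directions `i`, `i + 1` the cells form a double category with connections.
There folding loses nothing but the faces: `ConnSquares.unfold_psi` recovers a square `A` by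
composing its folding with connections and identities on faces of `A`. Connections on invertible
edges are invertible (`InvE.hm_cp`, `InvE.hm_cm`). So invertibility in direction `i` passes from `A`
to its folding, and back once the faces of `A` in direction `i + 1` are invertible (`InvH.psi`,
`InvH.of_psi`). For direction `i + 1` the square is first folded the other way: this does not change
its folding (`psi_transpose_psi`), and for squares with two identity sides folding turns inverses in
one direction into inverses in the other (`InvV.psi_of_degenerate`). In any third direction, all the
operations used in folding and unfolding respect inverses.

Thus folding along `i` sends direction `j` to `foldDir i j`, and after all the foldings every
direction has become the first one. The way back needs, at each stage, invertible faces of the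
partially folded cell; `FacesInvertible.psi` derives these from the faces of `A`. Finally, an
invertible shell amounts to invertible faces in the directions other than `j`, because uniqueness of
inverses makes the inverse faces fit together (`hasRInvertibleShell_iff`).

For thinness, folding turns identities and connections into identities, and composites into
composites of foldings with identities. Hence thin cells are closed under composition
(`ThinTo.mul`). Unfolding builds the inverse of `A` from connections, identities and the inverse of
a folding, which is thin by induction; uniqueness identifies the result with the given inverse. -/

/-! ### Double categories with connections -/

/-- A double category with connections whose horizontal and vertical edges coincide.  Compositions
are total functions, whose values are only meaningful on composable pairs.  A square has faces
`l`, `r` in the first direction and `b`, `t` in the second one. -/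
structure ConnSquares where
  /-- Vertices. -/
  V : Type u
  /-- Edges. -/
  E : Type u
  /-- Squares. -/
  Q : Type u
  /-- Source of an edge. -/
  src : E → V
  /-- Target of an edge. -/
  tgt : E → V
  /-- Identity edges. -/
  one : V → E
  /-- Composition of edges. -/
  mul : E → E → E
  /-- Source in the first direction. -/
  l : Q → E
  /-- Target in the first direction. -/
  r : Q → E
  /-- Source in the second direction. -/
  b : Q → E
  /-- Target in the second direction. -/
  t : Q → E
  /-- Identities of the first composition. -/
  hid : E → Q
  /-- Identities of the second composition. -/
  vid : E → Q
  /-- The connection `Γ⁺`. -/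
  cp : E → Q
  /-- The connection `Γ⁻`. -/
  cm : E → Q
  /-- Composition in the first direction. -/
  hm : Q → Q → Q
  /-- Composition in the second direction. -/
  vm : Q → Q → Q
  src_b : ∀ A, src (b A) = src (l A)
  tgt_b : ∀ A, tgt (b A) = src (r A)
  src_t : ∀ A, src (t A) = tgt (l A)
  tgt_t : ∀ A, tgt (t A) = tgt (r A)
  src_one : ∀ p, src (one p) = p
  tgt_one : ∀ p, tgt (one p) = p
  src_mul : ∀ x y, tgt x = src y → src (mul x y) = src x
  tgt_mul : ∀ x y, tgt x = src y → tgt (mul x y) = tgt y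
  one_mul : ∀ x p, p = src x → mul (one p) x = x
  mul_one : ∀ x p, p = tgt x → mul x (one p) = x
  mul_assoc : ∀ x y z, tgt x = src y → tgt y = src z → mul (mul x y) z = mul x (mul y z)
  l_hid : ∀ x, l (hid x) = x
  r_hid : ∀ x, r (hid x) = x
  b_hid : ∀ x, b (hid x) = one (src x)
  t_hid : ∀ x, t (hid x) = one (tgt x)
  l_vid : ∀ x, l (vid x) = one (src x)
  r_vid : ∀ x, r (vid x) = one (tgt x)
  b_vid : ∀ x, b (vid x) = x
  t_vid : ∀ x, t (vid x) = x
  l_cp : ∀ x, l (cp x) = one (src x)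
  r_cp : ∀ x, r (cp x) = x
  b_cp : ∀ x, b (cp x) = one (src x)
  t_cp : ∀ x, t (cp x) = x
  l_cm : ∀ x, l (cm x) = x
  r_cm : ∀ x, r (cm x) = one (tgt x)
  b_cm : ∀ x, b (cm x) = x
  t_cm : ∀ x, t (cm x) = one (tgt x)
  l_hm : ∀ A B, r A = l B → l (hm A B) = l A
  r_hm : ∀ A B, r A = l B → r (hm A B) = r B
  b_hm : ∀ A B, r A = l B → b (hm A B) = mul (b A) (b B)
  t_hm : ∀ A B, r A = l B → t (hm A B) = mul (t A) (t B)
  l_vm : ∀ A B, t A = b B → l (vm A B) = mul (l A) (l B)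
  r_vm : ∀ A B, t A = b B → r (vm A B) = mul (r A) (r B)
  b_vm : ∀ A B, t A = b B → b (vm A B) = b A
  t_vm : ∀ A B, t A = b B → t (vm A B) = t B
  exchange : ∀ A B X Y, r A = l B → r X = l Y → t A = b X → t B = b Y →
    hm (vm A X) (vm B Y) = vm (hm A B) (hm X Y)
  hm_assoc : ∀ A B X, r A = l B → r B = l X → hm (hm A B) X = hm A (hm B X)
  vm_assoc : ∀ A B X, t A = b B → t B = b X → vm (vm A B) X = vm A (vm B X)
  hid_hm : ∀ A x, x = l A → hm (hid x) A = A
  hm_hid : ∀ A x, x = r A → hm A (hid x) = A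
  vid_vm : ∀ A x, x = b A → vm (vid x) A = A
  vm_vid : ∀ A x, x = t A → vm A (vid x) = A
  hid_one : ∀ p, hid (one p) = vid (one p)
  cp_one : ∀ p, cp (one p) = vid (one p)
  cm_one : ∀ p, cm (one p) = vid (one p)
  hid_mul : ∀ x y, tgt x = src y → hid (mul x y) = vm (hid x) (hid y)
  vid_mul : ∀ x y, tgt x = src y → vid (mul x y) = hm (vid x) (vid y)
  cp_hm_cm : ∀ x, hm (cp x) (cm x) = vid x
  cp_vm_cm : ∀ x, vm (cp x) (cm x) = hid x
  cm_mul : ∀ x y, tgt x = src y → cm (mul x y) = vm (hm (cm x) (vid y)) (cm y)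
  cp_mul : ∀ x y, tgt x = src y → cp (mul x y) = vm (cp x) (hm (vid x) (cp y))

namespace ConnSquares

variable (S : ConnSquares.{u})

attribute [simp] src_b tgt_b src_t tgt_t src_one tgt_one src_mul tgt_mul one_mul mul_one
  l_hid r_hid b_hid t_hid l_vid r_vid b_vid t_vid l_cp r_cp b_cp t_cp l_cm r_cm b_cm t_cm
  l_hm r_hm b_hm t_hm l_vm r_vm b_vm t_vm hid_hm hm_hid vid_vm vm_vid hid_one cp_one cm_one
  cp_hm_cm cp_vm_cm

@[simp] theorem vid_one_hm (A : S.Q) (p : S.V) (h : S.one p = S.l A) :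
    S.hm (S.vid (S.one p)) A = A := by rw [← S.hid_one, S.hid_hm _ _ h]

@[simp] theorem hm_vid_one (A : S.Q) (p : S.V) (h : S.one p = S.r A) :
    S.hm A (S.vid (S.one p)) = A := by rw [← S.hid_one, S.hm_hid _ _ h]

theorem exchange_three {A B X A' B' X' : S.Q} (h1 : S.r A = S.l A') (h2 : S.r B = S.l B')
    (h3 : S.r X = S.l X') (k1 : S.t A = S.b B) (k2 : S.t B = S.b X) (k1' : S.t A' = S.b B')
    (k2' : S.t B' = S.b X') :
    S.hm (S.vm (S.vm A B) X) (S.vm (S.vm A' B') X') =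
      S.vm (S.vm (S.hm A A') (S.hm B B')) (S.hm X X') := by
  have k : S.r (S.vm A B) = S.l (S.vm A' B') := by simp [*]
  rw [S.exchange _ _ _ _ k h3 (by simp [*]) (by simp [*]), S.exchange _ _ _ _ h1 h2 k1 k1']

theorem exchange_five {A B X Y Z A' B' X' Y' Z' : S.Q} (h1 : S.r A = S.l A')
    (h2 : S.r B = S.l B') (h3 : S.r X = S.l X') (h4 : S.r Y = S.l Y') (h5 : S.r Z = S.l Z')
    (k1 : S.t A = S.b B) (k2 : S.t B = S.b X) (k3 : S.t X = S.b Y) (k4 : S.t Y = S.b Z)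
    (k1' : S.t A' = S.b B') (k2' : S.t B' = S.b X') (k3' : S.t X' = S.b Y')
    (k4' : S.t Y' = S.b Z') :
    S.hm (S.vm (S.vm (S.vm (S.vm A B) X) Y) Z) (S.vm (S.vm (S.vm (S.vm A' B') X') Y') Z') =
      S.vm (S.vm (S.vm (S.vm (S.hm A A') (S.hm B B')) (S.hm X X')) (S.hm Y Y')) (S.hm Z Z') := by
  have e3 : S.r (S.vm (S.vm A B) X) = S.l (S.vm (S.vm A' B') X') := by simp [*]
  have e4 : S.r (S.vm (S.vm (S.vm A B) X) Y) = S.l (S.vm (S.vm (S.vm A' B') X') Y') := by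
    simp (maxDischargeDepth := 5) [*]
  rw [S.exchange _ _ _ _ e4 h5 (by simp (maxDischargeDepth := 5) [*])
      (by simp (maxDischargeDepth := 5) [*]), S.exchange _ _ _ _ e3 h4 (by simp [*]) (by simp [*]),
    S.exchange_three h1 h2 h3 k1 k2 k1' k2']

/-- Exchanging the two directions. -/
def transpose : ConnSquares.{u} where
  V := S.V
  E := S.E
  Q := S.Q
  src := S.src
  tgt := S.tgt
  one := S.one
  mul := S.mul
  l := S.b
  r := S.t
  b := S.l
  t := S.r
  hid := S.vid
  vid := S.hid
  cp := S.cp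
  cm := S.cm
  hm := S.vm
  vm := S.hm
  src_b A := (S.src_b A).symm
  tgt_b A := (S.src_t A).symm
  src_t A := (S.tgt_b A).symm
  tgt_t A := (S.tgt_t A).symm
  src_one := S.src_one
  tgt_one := S.tgt_one
  src_mul := S.src_mul
  tgt_mul := S.tgt_mul
  one_mul := S.one_mul
  mul_one := S.mul_one
  mul_assoc := S.mul_assoc
  l_hid := S.b_vid
  r_hid := S.t_vid
  b_hid := S.l_vid
  t_hid := S.r_vid
  l_vid := S.b_hid
  r_vid := S.t_hid
  b_vid := S.l_hid
  t_vid := S.r_hid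
  l_cp := S.b_cp
  r_cp := S.t_cp
  b_cp := S.l_cp
  t_cp := S.r_cp
  l_cm := S.b_cm
  r_cm := S.t_cm
  b_cm := S.l_cm
  t_cm := S.r_cm
  l_hm := S.b_vm
  r_hm := S.t_vm
  b_hm := S.l_vm
  t_hm := S.r_vm
  l_vm := S.b_hm
  r_vm := S.t_hm
  b_vm := S.l_hm
  t_vm := S.r_hm
  exchange A B X Y h1 h2 h3 h4 := (S.exchange A X B Y h3 h4 h1 h2).symm
  hm_assoc := S.vm_assoc
  vm_assoc := S.hm_assoc
  hid_hm := S.vid_vm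
  hm_hid := S.vm_vid
  vid_vm := S.hid_hm
  vm_vid := S.hm_hid
  hid_one p := (S.hid_one p).symm
  cp_one p := (S.cp_one p).trans (S.hid_one p).symm
  cm_one p := (S.cm_one p).trans (S.hid_one p).symm
  hid_mul := S.vid_mul
  vid_mul := S.hid_mul
  cp_hm_cm := S.cp_vm_cm
  cp_vm_cm := S.cp_hm_cm
  cm_mul x y h := by
    have := S.exchange (S.cm x) (S.vid y) (S.hid y) (S.cm y) (by simp [h]) (by simp)
      (by simp [h]) (by simp)
    rw [S.cm_mul x y h]
    simpa using this.symm
  cp_mul x y h := by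
    have := S.exchange (S.cp x) (S.hid x) (S.vid x) (S.cp y) (by simp) (by simp [h])
      (by simp) (by simp [h])
    rw [S.cp_mul x y h]
    simpa using this.symm

/-! ### Folding and unfolding of squares -/

/-- The folding operation. -/
def psi (A : S.Q) : S.Q :=
  S.vm (S.vm (S.cp (S.b A)) A) (S.cm (S.t A))

@[simp] theorem l_psi (A : S.Q) : S.l (S.psi A) = S.mul (S.l A) (S.t A) := by simp [psi]

@[simp] theorem r_psi (A : S.Q) : S.r (S.psi A) = S.mul (S.b A) (S.r A) := by simp [psi]

@[simp] theorem b_psi (A : S.Q) : S.b (S.psi A) = S.one (S.src (S.l A)) := by simp [psi]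

@[simp] theorem t_psi (A : S.Q) : S.t (S.psi A) = S.one (S.tgt (S.r A)) := by simp [psi]

@[simp] theorem psi_hid (x : S.E) : S.psi (S.hid x) = S.hid x := by simp [psi]

@[simp] theorem psi_vid (x : S.E) : S.psi (S.vid x) = S.hid x := by simp [psi]

@[simp] theorem psi_cp (x : S.E) : S.psi (S.cp x) = S.hid x := by simp [psi]

@[simp] theorem psi_cm (x : S.E) : S.psi (S.cm x) = S.hid x := by simp [psi]

theorem psi_eq_self {A : S.Q} {p q : S.V} (hb : S.b A = S.one p) (ht : S.t A = S.one q) :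
    S.psi A = A := by
  simp [psi, hb, ht]

/-- The transport laws for the connections split the outer rows of the folding, giving a grid of
five rows and two columns. Reading it by columns gives the right-hand side. -/
theorem psi_hm {A B : S.Q} (h : S.r A = S.l B) :
    S.psi (S.hm A B) =
      S.hm (S.vm (S.psi A) (S.hid (S.t B))) (S.vm (S.hid (S.b A)) (S.psi B)) := by
  have := S.exchange_five (A := S.cp (S.b A)) (B := S.vid (S.b A)) (X := A) (Y := S.cm (S.t A))
    (Z := S.hid (S.t B)) (A' := S.hid (S.b A)) (B' := S.cp (S.b B)) (X' := B)
    (Y' := S.vid (S.t B)) (Z' := S.cm (S.t B)) (by simp) (by simp [h]) h (by simp [h]) (by simp)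
    (by simp) (by simp) (by simp) (by simp [h]) (by simp [h]) (by simp) (by simp) (by simp)
  rw [psi, S.b_hm _ _ h, S.t_hm _ _ h, S.cp_mul _ _ (by simp [h]), S.cm_mul _ _ (by simp [h])]
  simp only [psi]
  have e : S.src (S.t B) = S.tgt (S.t A) := by simp [h]
  simp (maxDischargeDepth := 5) [h, e, S.vm_assoc] at this ⊢
  exact this.symm

/-- In the grid of five rows and two columns on the right, the middle row is `Γ⁺` followed by `Γ⁻`
on the common edge. It composes to an identity and disappears, which leaves the folding of the
composite. The foldings of `A` and `B` occur in reversed order. -/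
theorem psi_vm {A B : S.Q} (h : S.t A = S.b B) :
    S.psi (S.vm A B) =
      S.hm (S.vm (S.hid (S.l A)) (S.psi B)) (S.vm (S.psi A) (S.hid (S.r B))) := by
  have e1 : S.src (S.l B) = S.tgt (S.l A) := by rw [← src_b, ← h, src_t]
  have e2 : S.src (S.r B) = S.tgt (S.r A) := by rw [← tgt_b, ← h, tgt_t]
  have := S.exchange_five (A := S.hid (S.one (S.src (S.b A)))) (B := S.hid (S.l A))
    (X := S.cp (S.t A)) (Y := B)
    (Z := S.cm (S.t B)) (A' := S.cp (S.b A)) (B' := A) (X' := S.cm (S.t A))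
    (Y' := S.hid (S.r B)) (Z' := S.hid (S.one (S.tgt (S.t B)))) (by simp) (by simp) (by simp)
    (by simp) (by simp) (by simp) (by simp) (by simp [h]) (by simp)
    (by simp) (by simp) (by simp [e2]) (by simp)
  simp only [psi]
  simp (maxDischargeDepth := 5) [h, e1, e2, S.vm_assoc] at this ⊢
  exact this.symm

/-- A square is recovered from its folding and its faces. -/
theorem unfold_psi (A : S.Q) :
    S.hm (S.hm (S.vm (S.hid (S.l A)) (S.cp (S.t A))) (S.psi A))
      (S.vm (S.cm (S.b A)) (S.hid (S.r A))) = A := by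
  -- `h1` cancels the lower connection `Γ⁻` of the folding against a `Γ⁺` placed on its left; `h2`
  -- then cancels the remaining `Γ⁺` against a `Γ⁻` on the right.
  have h1 := S.exchange_three (A := S.hid (S.one (S.src (S.b A)))) (B := S.hid (S.l A))
    (X := S.cp (S.t A)) (A' := S.cp (S.b A)) (B' := A) (X' := S.cm (S.t A)) (by simp) (by simp)
    (by simp) (by simp) (by simp) (by simp) (by simp)
  have h2 := S.exchange_three (A := S.cp (S.b A)) (B := A)
    (X := S.vid (S.t A)) (A' := S.cm (S.b A)) (B' := S.hid (S.r A))
    (X' := S.hid (S.one (S.tgt (S.t A)))) (by simp) (by simp)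
    (by simp) (by simp) (by simp) (by simp) (by simp)
  simp only [psi]
  simp at h1 h2 ⊢
  rw [h1, h2]

theorem unfold_psi_match (A : S.Q) :
    S.t (S.hid (S.l A)) = S.b (S.cp (S.t A)) ∧ S.t (S.cm (S.b A)) = S.b (S.hid (S.r A)) ∧
      S.r (S.vm (S.hid (S.l A)) (S.cp (S.t A))) = S.l (S.psi A) ∧
      S.r (S.hm (S.vm (S.hid (S.l A)) (S.cp (S.t A))) (S.psi A)) =
        S.l (S.vm (S.cm (S.b A)) (S.hid (S.r A))) := by
  simp

/-- The transposed folding only adds connections on either side, and these fold to identities. -/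
theorem psi_transpose_psi (A : S.Q) : S.psi (S.transpose.psi A) = S.psi A := by
  have h : S.transpose.psi A = S.hm (S.hm (S.cp (S.l A)) A) (S.cm (S.r A)) := rfl
  rw [h, S.psi_hm (by simp), S.psi_hm (by simp)]
  simp [← S.hid_mul]

/-! ### Inverse edges and inverse squares -/

/-- `x` and `y` are inverse edges. -/
structure InvE (x y : S.E) : Prop where
  tgt_src : S.tgt x = S.src y
  src_tgt : S.src x = S.tgt y
  mul_left : S.mul x y = S.one (S.src x)
  mul_right : S.mul y x = S.one (S.tgt x)

/-- `A` and `B` are inverse squares in the first direction. -/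
structure InvH (A B : S.Q) : Prop where
  r_l : S.r A = S.l B
  l_r : S.l A = S.r B
  hm_left : S.hm A B = S.hid (S.l A)
  hm_right : S.hm B A = S.hid (S.r A)

/-- `A` and `B` are inverse squares in the second direction. -/
def InvV (A B : S.Q) : Prop := S.transpose.InvH A B

variable {S}

theorem InvE.symm {x y : S.E} (h : S.InvE x y) : S.InvE y x :=
  ⟨h.2.symm, h.1.symm, by rw [h.4, h.1], by rw [h.3, h.2]⟩

theorem InvE.unique {x y z : S.E} (h : S.InvE x y) (h' : S.InvE x z) : y = z := by
  have := S.mul_assoc y x z h.2.symm h'.1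
  rw [h.4, h'.3, S.one_mul _ _ h'.1, S.mul_one _ _ h.2] at this
  exact this.symm

theorem InvH.b {A B : S.Q} (h : S.InvH A B) : S.InvE (S.b A) (S.b B) where
  tgt_src := by simp [h.1]
  src_tgt := by simp [h.2]
  mul_left := by rw [← S.b_hm _ _ h.1, h.3]; simp
  mul_right := by rw [← S.b_hm _ _ h.2.symm, h.4]; simp

theorem InvH.t {A B : S.Q} (h : S.InvH A B) : S.InvE (S.t A) (S.t B) where
  tgt_src := by simp [h.1]
  src_tgt := by simp [h.2]
  mul_left := by rw [← S.t_hm _ _ h.1, h.3]; simp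
  mul_right := by rw [← S.t_hm _ _ h.2.symm, h.4]; simp

theorem InvH.hid (x : S.E) : S.InvH (S.hid x) (S.hid x) := by
  constructor <;> simp

theorem InvH.vm_match {A B A' B' : S.Q} (hA : S.InvH A A') (hB : S.InvH B B')
    (h : S.t A = S.b B) : S.t A' = S.b B' :=
  hA.t.unique (h ▸ hB.b)

theorem InvH.vm {A B A' B' : S.Q} (hA : S.InvH A A') (hB : S.InvH B B') (h : S.t A = S.b B) :
    S.InvH (S.vm A B) (S.vm A' B') := by
  have h' := hA.vm_match hB h
  have e : S.tgt (S.l A) = S.src (S.l B) := by rw [← src_t, h, src_b]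
  have e' : S.tgt (S.r A) = S.src (S.r B) := by rw [← tgt_t, h, tgt_b]
  constructor
  · simp [h, h', hA.1, hB.1]
  · simp [h, h', hA.2, hB.2]
  · rw [S.exchange _ _ _ _ hA.1 hB.1 h h', hA.3, hB.3, S.l_vm _ _ h, S.hid_mul _ _ e]
  · rw [S.exchange _ _ _ _ hA.2.symm hB.2.symm h' h, hA.4, hB.4, S.r_vm _ _ h, S.hid_mul _ _ e']

theorem InvH.hm {A B A' B' : S.Q} (hA : S.InvH A A') (hB : S.InvH B B') (h : S.r A = S.l B) :
    S.InvH (S.hm A B) (S.hm B' A') := by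
  have h' : S.r B' = S.l A' := by rw [← hA.1, h, hB.2]
  constructor
  · simp [h, h', hB.1]
  · simp [h, h', hA.2]
  · rw [S.hm_assoc _ _ _ h (by simp [h', hB.1]), ← S.hm_assoc B _ _ hB.1 h', hB.3,
      S.hid_hm _ _ (by rw [← h, hA.1]), hA.3, S.l_hm _ _ h]
  · rw [S.hm_assoc _ _ _ h' (by simp [h, hA.2]), ← S.hm_assoc A' _ _ hA.2.symm h, hA.4,
      S.hid_hm _ _ h, hB.4, S.r_hm _ _ h]

/-- Apply the transposed law for `Γ⁻` of a composite to `x` and `y`: the composite is an identity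
edge, so its connection is an identity square, and the law becomes a one-sided inverse equation. -/
theorem InvE.hm_cm {x y : S.E} (h : S.InvE x y) :
    S.InvH (S.cm x) (S.vm (S.cm y) (S.hid x)) := by
  have key : ∀ {x y : S.E}, S.InvE x y →
      S.hm (S.vm (S.cm x) (S.hid y)) (S.cm y) = S.hid (S.one (S.src x)) := by
    intro x y h
    have e := S.transpose.cm_mul x y h.1
    have e1 : S.transpose.mul x y = S.one (S.src x) := h.3
    rw [e1] at e
    refine e.symm.trans ((S.cm_one _).trans (S.hid_one _).symm)
  have e := h.1
  have e' := h.2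
  constructor
  · simp [e, e', h.4]
  · simp [e']
  · have k := key h
    -- Padding with the trivial product of `y` and `x` makes the exchange law applicable, and `key`
    -- then collapses the first row.
    have hx : S.cm x = S.vm (S.vm (S.cm x) (S.hid y)) (S.hid x) := by
      rw [S.vm_assoc _ _ _ (by simp [e]) (by simp [e']), ← S.hid_mul _ _ e'.symm, h.4]
      simp
    rw [hx, S.exchange _ _ _ _ (by simp [e]) (by simp) (by simp [e, e']) (by simp [e']), k]
    simp [e, e', h.3]
  · rw [key h.symm]; simp [e]

theorem InvE.hm_cp {x y : S.E} (h : S.InvE x y) :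
    S.InvH (S.cp x) (S.vm (S.hid x) (S.cp y)) := by
  have key : ∀ {x y : S.E}, S.InvE x y →
      S.hm (S.cp x) (S.vm (S.hid x) (S.cp y)) = S.hid (S.one (S.src x)) := by
    intro x y h
    have e := S.transpose.cp_mul x y h.1
    have e1 : S.transpose.mul x y = S.one (S.src x) := h.3
    rw [e1] at e
    refine e.symm.trans ((S.cp_one _).trans (S.hid_one _).symm)
  have e := h.1
  have e' := h.2
  constructor
  · simp [e]
  · simp [e, e', h.3]
  · rw [key h]; simp
  · have k := key h.symm
    have hx : S.cp x = S.vm (S.hid x) (S.vm (S.hid y) (S.cp x)) := by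
      rw [← S.vm_assoc _ _ _ (by simp [e]) (by simp [e']), ← S.hid_mul _ _ e, h.3]
      simp
    have hm1 : S.t (S.hid y) = S.b (S.cp x) := by simp [e']
    have k' := S.exchange (S.hid x) (S.hid x) (S.cp y) (S.vm (S.hid y) (S.cp x)) (by simp)
      (by simp [hm1, e']) (by simp [e]) (by simp [hm1, e])
    rw [← hx, k] at k'
    rw [k']
    simp [e]

/-! ### Classes closed under composition, and inverses across folding -/

/-- Classes of squares that contain the identities and the connections and are closed under
composition. -/
structure Closed (T : S.Q → Prop) : Prop where
  hid : ∀ x, T (S.hid x)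
  vid : ∀ x, T (S.vid x)
  cp : ∀ x, T (S.cp x)
  cm : ∀ x, T (S.cm x)
  hm : ∀ A B, S.r A = S.l B → T A → T B → T (S.hm A B)
  vm : ∀ A B, S.t A = S.b B → T A → T B → T (S.vm A B)

theorem Closed.transpose {T : S.Q → Prop} (h : Closed T) : Closed (S := S.transpose) T :=
  ⟨h.2, h.1, h.3, h.4, h.6, h.5⟩

theorem Closed.psi {T : S.Q → Prop} (h : Closed T) {A : S.Q} (hA : T A) : T (S.psi A) :=
  h.vm _ _ (by simp) (h.vm _ _ (by simp) (h.cp _) hA) (h.cm _)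

/-- This is the class to use when only the existence of an inverse matters; thinness supplies the
other one. -/
theorem closed_true : Closed (S := S) (fun _ => True) := by
  constructor <;> simp

/-- All generators fold to some `hid x`, so `T` itself need not contain the connections or the other
identities. -/
theorem closed_comap_psi {T : S.Q → Prop} (hid : ∀ x, T (S.hid x))
    (hm : ∀ A B, S.r A = S.l B → T A → T B → T (S.hm A B))
    (vm : ∀ A B, S.t A = S.b B → T A → T B → T (S.vm A B)) :
    Closed (S := S) (fun A => T (S.psi A)) where
  hid x := by simpa using hid x
  vid x := by simpa using hid x
  cp x := by simpa using hid x
  cm x := by simpa using hid x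
  hm A B h hA hB := by
    rw [S.psi_hm h]
    exact hm _ _ (by simp [h, S.mul_assoc]) (vm _ _ (by simp [h]) hA (hid _))
      (vm _ _ (by simp [h]) (hid _) hB)
  vm A B h hA hB := by
    have e1 : S.src (S.l B) = S.tgt (S.l A) := by rw [← src_b, ← h, src_t]
    have e2 : S.src (S.r B) = S.tgt (S.r A) := by rw [← tgt_b, ← h, tgt_t]
    rw [S.psi_vm h]
    exact hm _ _ (by simp [h, e1, e2, S.mul_assoc]) (vm _ _ (by simp [e1]) (hid _) hB)
      (vm _ _ (by simp [e2]) hA (hid _))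

theorem InvH.psi {A B : S.Q} (h : S.InvH A B) : ∃ Z, S.InvH (S.psi A) Z :=
  ⟨_, (h.b.hm_cp.vm h (by simp)).vm h.t.hm_cm (by simp)⟩

theorem InvV.r_l {A B : S.Q} (h : S.InvV A B) : S.t A = S.b B := InvH.r_l h

theorem InvV.l_r {A B : S.Q} (h : S.InvV A B) : S.b A = S.t B := InvH.l_r h

theorem InvV.vm_left {A B : S.Q} (h : S.InvV A B) : S.vm A B = S.vid (S.b A) := InvH.hm_left h

theorem InvV.vm_right {A B : S.Q} (h : S.InvV A B) : S.vm B A = S.vid (S.t A) := InvH.hm_right h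

theorem InvV.l {A B : S.Q} (h : S.InvV A B) : S.InvE (S.l A) (S.l B) := by
  have := InvH.b h
  exact ⟨this.1, this.2, this.3, this.4⟩

theorem InvV.r {A B : S.Q} (h : S.InvV A B) : S.InvE (S.r A) (S.r B) := by
  have := InvH.t h
  exact ⟨this.1, this.2, this.3, this.4⟩

theorem InvE.one (p : S.V) : S.InvE (S.one p) (S.one p) := by constructor <;> simp

/-- With identity sides, the padding in `psi_vm` vanishes, so folding turns vertical composition
into horizontal composition in the opposite order. -/
theorem InvV.psi_of_degenerate {A B : S.Q} (h : S.InvV A B) {p q : S.V} (hp : S.l A = S.one p)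
    (hq : S.r A = S.one q) : S.InvH (S.psi A) (S.psi B) := by
  have hp' : S.l B = S.one p := (hp ▸ h.l).unique (InvE.one p)
  have hq' : S.r B = S.one q := (hq ▸ h.r).unique (InvE.one q)
  have hl := h.r_l
  have hr := h.l_r
  have e1 := S.src_b A
  have e2 := S.tgt_b A
  have e3 := S.src_t A
  have e4 := S.tgt_t A
  have e5 := S.src_b B
  have e6 := S.tgt_b B
  have e7 := S.src_t B
  have e8 := S.tgt_t B
  simp only [hp, hq, hp', hq', S.src_one, S.tgt_one] at e1 e2 e3 e4 e5 e6 e7 e8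
  have k1 := S.psi_vm h.l_r.symm
  have k2 := S.psi_vm h.r_l
  rw [h.vm_right] at k1
  rw [h.vm_left] at k2
  simp only [psi_vid, hp, hq, hp', hq', S.hid_one] at k1 k2
  rw [S.vid_vm _ _ (by simp [hp]), S.vm_vid _ _ (by simp [hq'])] at k1
  rw [S.vid_vm _ _ (by simp [hp']), S.vm_vid _ _ (by simp [hq])] at k2
  constructor
  · simp [*]
  · simp [*]
  · rw [← k1]; simp [*]
  · rw [← k2]; simp [*]

/-- The transposed folding is vertically invertible and has identity sides, so its own folding is
horizontally invertible; that folding is also the folding of `A`. -/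
theorem InvV.psi {A B : S.Q} (h : S.InvV A B) : ∃ Z, S.InvH (S.psi A) Z := by
  obtain ⟨Z, hZ⟩ := InvH.psi (S := S.transpose) h
  have := InvV.psi_of_degenerate (S := S) hZ (S.transpose.b_psi A) (S.transpose.t_psi A)
  rw [psi_transpose_psi] at this
  exact ⟨_, this⟩

/-- The bottom and top of `Z` are inverse to identity edges, hence are identities. This lets
thinness of `Z` be read before or after folding. -/
theorem InvH.psi_eq_self {A Z : S.Q} (h : S.InvH (S.psi A) Z) : S.psi Z = Z := by
  have hb := h.b
  have ht := h.t
  rw [b_psi] at hb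
  rw [t_psi] at ht
  exact S.psi_eq_self (hb.unique (InvE.one _)) (ht.unique (InvE.one _))

/-- Each of the three factors in `unfold_psi` is invertible. The inverse is an explicit composite of
`Z`, connections and identities, so it stays in `T`. -/
theorem InvH.of_psi {T : S.Q → Prop} (hT : Closed T) {A Z : S.Q} (h : S.InvH (S.psi A) Z)
    (hZ : T Z) {x y : S.E} (hb : S.InvE (S.b A) x) (ht : S.InvE (S.t A) y) :
    ∃ B, T B ∧ S.InvH A B := by
  have h1 := (InvH.hid (S.l A)).vm ht.hm_cp (by simp)
  have h2 := hb.hm_cm.vm (InvH.hid (S.r A)) (by simp)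
  have h3 := (h1.hm h (by simp)).hm h2 (by simp)
  rw [unfold_psi] at h3
  refine ⟨_, ?_, h3⟩
  have m1 : S.t (S.hid (S.t A)) = S.b (S.cp y) := by simp [ht.1]
  have m2 : S.t (S.cm x) = S.b (S.hid (S.b A)) := by simp [hb.2]
  refine hT.hm _ _ ?_ (hT.vm _ _ ?_ (hT.vm _ _ ?_ (hT.cm _) (hT.hid _)) (hT.hid _))
    (hT.hm _ _ ?_ hZ (hT.vm _ _ ?_ (hT.hid _) (hT.vm _ _ m1 (hT.hid _) (hT.cp _))))
  · have k := h1.r_l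
    rw [S.l_hm _ _ (by rw [← h.l_r, ← h1.r_l]; simp), ← h2.l_r, ← h.r_l]
    simp
  · simp [m2]
  · exact m2
  · rw [← h.l_r, ← h1.r_l]; simp
  · simp [m1]

/-- The transposed folding of `psi A` is vertically invertible and coincides with that of `A`, so
the transposed horizontal case applies. -/
theorem InvV.of_psi {T : S.Q → Prop} (hT : Closed T) {A Z : S.Q} (h : S.InvH (S.psi A) Z)
    (hZ : T Z) {x y : S.E} (hl : S.InvE (S.l A) x) (hr : S.InvE (S.r A) y) :
    ∃ B, T B ∧ S.InvV A B := by
  have h1 := InvV.psi_of_degenerate (S := S.transpose) h (S.b_psi A) (S.t_psi A)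
  have h2 : S.transpose.psi (S.psi A) = S.transpose.psi A := S.transpose.psi_transpose_psi A
  rw [h2] at h1
  exact InvH.of_psi (S := S.transpose) hT.transpose h1 (hT.transpose.psi hZ)
    (x := x) (y := y) ⟨hl.1, hl.2, hl.3, hl.4⟩ ⟨hr.1, hr.2, hr.3, hr.4⟩

end ConnSquares

/-! ### Directions transverse to an adjacent pair -/

theorem lowerIndex_castSucc_eq_succ {n : ℕ} (i : Fin (n + 1)) {j : Fin (n + 2)}
    (h : j ≠ i.castSucc) (h' : j ≠ i.succ) : lowerIndex i.castSucc j = lowerIndex i.succ j := by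
  simp only [lowerIndex, ne_eq, Fin.ext_iff, Fin.val_castSucc, Fin.val_succ] at *
  split_ifs <;> omega

theorem lowerIndex_castSucc_self {n : ℕ} (i : Fin (n + 1)) : lowerIndex i.castSucc i.succ = i := by
  simp [lowerIndex]

theorem lowerIndex_succ_self {n : ℕ} (i : Fin (n + 1)) : lowerIndex i.succ i.castSucc = i := by
  simp [lowerIndex]

/-- A direction other than `i` and `i + 1` comes from a direction `k ≠ i`. -/
theorem exists_lt_or_gt {n : ℕ} (i : Fin (n + 1)) (j : Fin (n + 2)) (h : j ≠ i.castSucc)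
    (h' : j ≠ i.succ) : ∃ k : Fin (n + 1), lowerIndex i.castSucc j = k ∧
      ((k < i ∧ j = k.castSucc) ∨ (i < k ∧ j = k.succ)) := by
  refine ⟨_, rfl, ?_⟩
  simp only [lowerIndex, ne_eq, Fin.ext_iff, Fin.lt_def, Fin.val_castSucc, Fin.val_succ] at *
  split_ifs <;> omega

namespace CubicalSet

variable {X : CubicalSet.{u}}

theorem face_eps_ne {n : ℕ} (i j : Fin (n + 2)) (h : i ≠ j) (α : Side) (A : X.cell (n + 1)) :
    X.face i α (X.eps j A) = X.eps (lowerIndex i j) (X.face (lowerIndex j i) α A) := by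
  rw [← X.epsFace_eq]
  simp [epsFace, h]

theorem conn_eps_face {n : ℕ} (i : Fin (n + 1)) (j : Fin (n + 2)) (h : j ≠ i.castSucc)
    (h' : j ≠ i.succ) (α β : Side) (x : X.cell (n + 1)) :
    X.conn i α (X.eps (lowerIndex i.castSucc j) (X.face (lowerIndex i.castSucc j) β x)) =
      X.eps j (X.face j β (X.conn i α x)) := by
  obtain ⟨k, hk, ⟨hlt, rfl⟩ | ⟨hlt, rfl⟩⟩ := exists_lt_or_gt i j h h' <;> rw [hk]
  · obtain ⟨i, rfl⟩ := Fin.eq_succ_of_ne_zero (Fin.ne_zero_of_lt hlt)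
    have hle : k ≤ i.castSucc := by simpa [Fin.lt_def, Fin.le_def, Nat.lt_succ_iff] using hlt
    obtain _ | n := n
    · exact i.elim0
    rw [X.conn_eps_gt _ _ _ _ hle, X.face_conn_lt _ _ _ _ _ hle]
  · obtain ⟨i, rfl⟩ := Fin.exists_castSucc_eq.2 (Fin.ne_last_of_lt hlt)
    obtain _ | n := n
    · exact i.elim0
    rw [X.conn_eps_lt _ _ _ _ hlt, X.face_conn_gt _ _ _ _ _ hlt]

/-- The degeneracy of a transverse face of a connection depends only on a face of the base cell, and
a further face map undoes the degeneracy. This avoids separating the cases `j < i` and `j > i + 1`.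
-/
theorem face_conn_congr {n : ℕ} (i : Fin (n + 1)) (j : Fin (n + 2)) (h : j ≠ i.castSucc)
    (h' : j ≠ i.succ) (α β γ : Side) {x y : X.cell (n + 1)}
    (e : X.face (lowerIndex i.castSucc j) β x = X.face (lowerIndex i.castSucc j) γ y) :
    X.face j β (X.conn i α x) = X.face j γ (X.conn i α y) := by
  rw [← X.face_eps_self j β (X.face j β (X.conn i α x)), ← X.conn_eps_face i j h h', e,
    X.conn_eps_face i j h h', X.face_eps_self]

end CubicalSet

/-! ### Total composition and its laws -/

namespace CubicalOmegaCategory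

variable {C : CubicalOmegaCategory.{u}}

variable (C) in
open Classical in
/-- The composition, extended by `A` to the pairs `(A, B)` that are not composable. -/
noncomputable def mul {n : ℕ} (k : Fin (n + 1)) (A B : C.cell (n + 1)) : C.cell (n + 1) :=
  if h : C.face k Side.plus A = C.face k Side.minus B then C.comp k A B h else A

theorem mul_eq_comp {n : ℕ} (k : Fin (n + 1)) (A B : C.cell (n + 1)) (h) :
    C.mul k A B = C.comp k A B h := dif_pos h

theorem face_minus_mul {n : ℕ} (k : Fin (n + 1)) (A B : C.cell (n + 1))
    (h : C.face k Side.plus A = C.face k Side.minus B) :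
    C.face k Side.minus (C.mul k A B) = C.face k Side.minus A := by
  rw [mul_eq_comp _ _ _ h, C.face_minus_comp]

theorem face_plus_mul {n : ℕ} (k : Fin (n + 1)) (A B : C.cell (n + 1))
    (h : C.face k Side.plus A = C.face k Side.minus B) :
    C.face k Side.plus (C.mul k A B) = C.face k Side.plus B := by
  rw [mul_eq_comp _ _ _ h, C.face_plus_comp]

theorem face_face_match {n : ℕ} {i k : Fin (n + 2)} (hik : i ≠ k) (α : Side) {β γ : Side}
    {A B : C.cell (n + 2)} (h : C.face k β A = C.face k γ B) :
    C.face (lowerIndex i k) β (C.face i α A) = C.face (lowerIndex i k) γ (C.face i α B) := by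
  rw [← C.face_lower i k hik, ← C.face_lower i k hik, h]

theorem face_mul {n : ℕ} (i k : Fin (n + 2)) (hik : i ≠ k) (α : Side) (A B : C.cell (n + 2))
    (h : C.face k Side.plus A = C.face k Side.minus B) :
    C.face i α (C.mul k A B) = C.mul (lowerIndex i k) (C.face i α A) (C.face i α B) := by
  rw [mul_eq_comp _ _ _ h, mul_eq_comp _ _ _ (face_face_match hik α h),
    C.face_comp _ _ hik]

theorem mul_exchange {n : ℕ} (i j : Fin (n + 1)) (hij : i ≠ j) (A B X Y : C.cell (n + 1))
    (h₁ : C.face i Side.plus A = C.face i Side.minus B)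
    (h₂ : C.face i Side.plus X = C.face i Side.minus Y)
    (h₃ : C.face j Side.plus A = C.face j Side.minus X)
    (h₄ : C.face j Side.plus B = C.face j Side.minus Y) :
    C.mul j (C.mul i A B) (C.mul i X Y) = C.mul i (C.mul j A X) (C.mul j B Y) := by
  obtain _ | n := n
  · omega
  have h₅ : C.face j Side.plus (C.mul i A B) = C.face j Side.minus (C.mul i X Y) := by
    rw [face_mul _ _ hij.symm _ _ _ h₁, face_mul _ _ hij.symm _ _ _ h₂, h₃, h₄]
  have h₆ : C.face i Side.plus (C.mul j A X) = C.face i Side.minus (C.mul j B Y) := by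
    rw [face_mul _ _ hij _ _ _ h₃, face_mul _ _ hij _ _ _ h₄, h₁, h₂]
  rw [mul_eq_comp _ _ _ h₅, mul_eq_comp _ _ _ h₆]
  simp only [mul_eq_comp _ _ _ h₁, mul_eq_comp _ _ _ h₂, mul_eq_comp _ _ _ h₃,
    mul_eq_comp _ _ _ h₄]
  exact C.exchange i j A B X Y h₁ h₂ _ h₃ h₄ _ hij

theorem mul_assoc {n : ℕ} (i : Fin (n + 1)) (A B X : C.cell (n + 1))
    (h₁ : C.face i Side.plus A = C.face i Side.minus B)
    (h₂ : C.face i Side.plus B = C.face i Side.minus X) :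
    C.mul i (C.mul i A B) X = C.mul i A (C.mul i B X) := by
  have h₃ : C.face i Side.plus A = C.face i Side.minus (C.mul i B X) := by
    rw [face_minus_mul _ _ _ h₂, h₁]
  have h₄ : C.face i Side.plus (C.mul i A B) = C.face i Side.minus X := by
    rw [face_plus_mul _ _ _ h₁, h₂]
  rw [mul_eq_comp _ _ _ h₃, mul_eq_comp _ _ _ h₄]
  simp only [mul_eq_comp _ _ _ h₁, mul_eq_comp _ _ _ h₂]
  exact (C.assoc i A B X h₂ _ h₁ _).symm

theorem mul_eps {n : ℕ} (i : Fin (n + 1)) (A : C.cell (n + 1)) (x : C.cell n)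
    (h : x = C.face i Side.plus A) : C.mul i A (C.eps i x) = A := by
  subst h
  rw [mul_eq_comp _ _ _ (C.face_eps_self _ _ _).symm, C.comp_eps]

theorem eps_mul {n : ℕ} (i : Fin (n + 1)) (A : C.cell (n + 1)) (x : C.cell n)
    (h : x = C.face i Side.minus A) : C.mul i (C.eps i x) A = A := by
  subst h
  rw [mul_eq_comp _ _ _ (C.face_eps_self _ _ _), C.eps_comp]

theorem eps_map_mul {n : ℕ} (i j : Fin (n + 2)) (hij : i ≠ j) (A B : C.cell (n + 1))
    (h : C.face (lowerIndex i j) Side.plus A = C.face (lowerIndex i j) Side.minus B) :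
    C.eps i (C.mul (lowerIndex i j) A B) = C.mul j (C.eps i A) (C.eps i B) := by
  have h' : C.face j Side.plus (C.eps i A) = C.face j Side.minus (C.eps i B) := by
    rw [C.face_eps_ne _ _ hij.symm, C.face_eps_ne _ _ hij.symm, h]
  rw [mul_eq_comp _ _ _ h, mul_eq_comp _ _ _ h']
  rcases lt_or_gt_of_ne hij with hl | hl <;>
    obtain ⟨a, b, hab, rfl, rfl⟩ := exists_castSucc_succ _ _ hl
  · have e := lowerIndex_castSucc_succ hab
    exact (congrArg _ (C.comp_congr e rfl rfl _ (by rwa [e] at h))).trans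
      (C.eps_comp_le a b A B _ h' hab)
  · have e := lowerIndex_succ_castSucc hab
    exact (congrArg _ (C.comp_congr e rfl rfl _ (by rwa [e] at h))).trans
      (C.eps_comp_gt b a A B _ h' hab)

theorem conn_map_mul {n : ℕ} (i : Fin (n + 1)) (j : Fin (n + 2)) (hj : j ≠ i.castSucc)
    (hj' : j ≠ i.succ) (α : Side) (A B : C.cell (n + 1))
    (h : C.face (lowerIndex i.castSucc j) Side.plus A =
      C.face (lowerIndex i.castSucc j) Side.minus B) :
    C.conn i α (C.mul (lowerIndex i.castSucc j) A B) = C.mul j (C.conn i α A) (C.conn i α B) := by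
  rw [mul_eq_comp _ _ _ h, mul_eq_comp _ _ _ (C.face_conn_congr i j hj hj' α _ _ h)]
  obtain ⟨k, hk, ⟨hlt, rfl⟩ | ⟨hlt, rfl⟩⟩ := exists_lt_or_gt i j hj hj'
  · exact (congrArg _ (C.comp_congr hk rfl rfl _ (by rwa [hk] at h))).trans
      (C.conn_comp_gt i k α A B _ _ hlt)
  · exact (congrArg _ (C.comp_congr hk rfl rfl _ (by rwa [hk] at h))).trans
      (C.conn_comp_lt i k α A B _ _ hlt)

theorem isRInverse_iff {n : ℕ} {k : Fin (n + 1)} {A B : C.cell (n + 1)} :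
    C.IsRInverse k A B ↔ C.face k Side.plus A = C.face k Side.minus B ∧
      C.face k Side.plus B = C.face k Side.minus A ∧
      C.mul k A B = C.eps k (C.face k Side.minus A) ∧
      C.mul k B A = C.eps k (C.face k Side.plus A) := by
  constructor
  · rintro ⟨h₁, h₂, h₃, h₄⟩
    exact ⟨h₁, h₂, by rw [mul_eq_comp _ _ _ h₁, h₃], by rw [mul_eq_comp _ _ _ h₂, h₄]⟩
  · rintro ⟨h₁, h₂, h₃, h₄⟩
    exact ⟨h₁, h₂, by rw [← mul_eq_comp _ _ _ h₁, h₃], by rw [← mul_eq_comp _ _ _ h₂, h₄]⟩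

/-! ### Stability of inverses under the cubical operations -/

namespace IsRInverse

theorem unique {n : ℕ} {k : Fin (n + 1)} {A B B' : C.cell (n + 1)} (h : C.IsRInverse k A B)
    (h' : C.IsRInverse k A B') : B = B' := by
  obtain ⟨-, h₂, -, h₄⟩ := isRInverse_iff.1 h
  obtain ⟨h₁', -, h₃', -⟩ := isRInverse_iff.1 h'
  have := C.mul_assoc k B A B' h₂ h₁'
  rw [h₄, h₃', C.eps_mul _ _ _ h₁', C.mul_eps _ _ _ h₂.symm] at this
  exact this.symm

theorem of_eps {n : ℕ} (k : Fin (n + 1)) (x : C.cell n) :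
    C.IsRInverse k (C.eps k x) (C.eps k x) := by
  refine isRInverse_iff.2 ⟨?_, ?_, ?_, ?_⟩ <;> simp [C.face_eps_self, C.eps_mul]

theorem face {n : ℕ} {k : Fin (n + 2)} {A B : C.cell (n + 2)} (h : C.IsRInverse k A B)
    (l : Fin (n + 2)) (hl : l ≠ k) (α : Side) :
    C.IsRInverse (lowerIndex l k) (C.face l α A) (C.face l α B) := by
  obtain ⟨h₁, h₂, h₃, h₄⟩ := isRInverse_iff.1 h
  refine isRInverse_iff.2 ⟨face_face_match hl α h₁, face_face_match hl α h₂, ?_, ?_⟩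
  · rw [← C.face_mul _ _ hl _ _ _ h₁, h₃, C.face_eps_ne _ _ hl, C.face_lower l k hl]
  · rw [← C.face_mul _ _ hl _ _ _ h₂, h₄, C.face_eps_ne _ _ hl, C.face_lower l k hl]

theorem eps {n : ℕ} {i j : Fin (n + 2)} (hij : i ≠ j) {x y : C.cell (n + 1)}
    (h : C.IsRInverse (lowerIndex i j) x y) : C.IsRInverse j (C.eps i x) (C.eps i y) := by
  obtain ⟨h₁, h₂, h₃, h₄⟩ := isRInverse_iff.1 h
  have key : ∀ (β) (z : C.cell (n + 1)),
      C.eps i (C.eps (lowerIndex i j) (C.face (lowerIndex i j) β z)) =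
        C.eps j (C.face j β (C.eps i z)) := by
    intro β z
    rw [C.face_eps_ne _ _ hij.symm]
    rcases lt_or_gt_of_ne hij with hl | hl <;>
      obtain ⟨a, b, hab, rfl, rfl⟩ := exists_castSucc_succ _ _ hl
    · rw [lowerIndex_castSucc_succ hab, lowerIndex_succ_castSucc hab, C.eps_eps _ _ _ hab]
    · rw [lowerIndex_castSucc_succ hab, lowerIndex_succ_castSucc hab, C.eps_eps _ _ _ hab]
  refine isRInverse_iff.2 ⟨?_, ?_, ?_, ?_⟩
  · rw [C.face_eps_ne _ _ hij.symm, C.face_eps_ne _ _ hij.symm, h₁]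
  · rw [C.face_eps_ne _ _ hij.symm, C.face_eps_ne _ _ hij.symm, h₂]
  · rw [← C.eps_map_mul _ _ hij _ _ h₁, h₃, key]
  · rw [← C.eps_map_mul _ _ hij _ _ h₂, h₄, key]

theorem conn {n : ℕ} {i : Fin (n + 1)} {j : Fin (n + 2)} (hj : j ≠ i.castSucc)
    (hj' : j ≠ i.succ) (α : Side) {x y : C.cell (n + 1)}
    (h : C.IsRInverse (lowerIndex i.castSucc j) x y) :
    C.IsRInverse j (C.conn i α x) (C.conn i α y) := by
  obtain ⟨h₁, h₂, h₃, h₄⟩ := isRInverse_iff.1 h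
  refine isRInverse_iff.2 ⟨C.face_conn_congr i j hj hj' α _ _ h₁,
    C.face_conn_congr i j hj hj' α _ _ h₂, ?_, ?_⟩
  · rw [← C.conn_map_mul _ _ hj hj' _ _ _ h₁, h₃, C.conn_eps_face i j hj hj']
  · rw [← C.conn_map_mul _ _ hj hj' _ _ _ h₂, h₄, C.conn_eps_face i j hj hj']

theorem mul {n : ℕ} {i k : Fin (n + 1)} (hik : i ≠ k) {A B A' B' : C.cell (n + 1)}
    (hA : C.IsRInverse k A A') (hB : C.IsRInverse k B B')
    (h : C.face i Side.plus A = C.face i Side.minus B) :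
    C.IsRInverse k (C.mul i A B) (C.mul i A' B') := by
  obtain _ | n := n
  · omega
  -- Both faces are inverse to the common face of `A` and `B`, so they agree.
  have h' : C.face i Side.plus A' = C.face i Side.minus B' :=
    (hA.face i hik Side.plus).unique (h ▸ hB.face i hik Side.minus)
  obtain ⟨a₁, a₂, a₃, a₄⟩ := isRInverse_iff.1 hA
  obtain ⟨b₁, b₂, b₃, b₄⟩ := isRInverse_iff.1 hB
  have hk := hik.symm
  have key : ∀ β, C.mul i (C.eps k (C.face k β A)) (C.eps k (C.face k β B)) =
      C.eps k (C.face k β (C.mul i A B)) := by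
    intro β
    rw [← C.eps_map_mul _ _ hk _ _ (face_face_match hk β h), C.face_mul _ _ hk _ _ _ h]
  refine isRInverse_iff.2 ⟨?_, ?_, ?_, ?_⟩
  · rw [C.face_mul _ _ hk _ _ _ h, C.face_mul _ _ hk _ _ _ h', a₁, b₁]
  · rw [C.face_mul _ _ hk _ _ _ h, C.face_mul _ _ hk _ _ _ h', a₂, b₂]
  · rw [C.mul_exchange _ _ hik _ _ _ _ h h' a₁ b₁, a₃, b₃, key]
  · rw [C.mul_exchange _ _ hik _ _ _ _ h' h a₂ b₂, a₄, b₄, key]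

end IsRInverse

/-! ### Squares in two adjacent directions -/

variable (C) in
/-- The cells of `C`, seen as squares in the directions `i` and `i + 1`. -/
noncomputable def squares {n : ℕ} (i : Fin (n + 1)) : ConnSquares.{u} where
  V := C.cell n
  E := C.cell (n + 1)
  Q := C.cell (n + 2)
  src := C.face i Side.minus
  tgt := C.face i Side.plus
  one := C.eps i
  mul := C.mul i
  l := C.face i.castSucc Side.minus
  r := C.face i.castSucc Side.plus
  b := C.face i.succ Side.minus
  t := C.face i.succ Side.plus
  hid := C.eps i.castSucc
  vid := C.eps i.succ
  cp := C.conn i Side.plus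
  cm := C.conn i Side.minus
  hm := C.mul i.castSucc
  vm := C.mul i.succ
  src_b A := C.face_face i i _ _ A le_rfl
  tgt_b A := C.face_face i i _ _ A le_rfl
  src_t A := C.face_face i i _ _ A le_rfl
  tgt_t A := C.face_face i i _ _ A le_rfl
  src_one p := C.face_eps_self _ _ p
  tgt_one p := C.face_eps_self _ _ p
  src_mul x y h := C.face_minus_mul i x y h
  tgt_mul x y h := C.face_plus_mul i x y h
  one_mul x p h := C.eps_mul i x p h
  mul_one x p h := C.mul_eps i x p h
  mul_assoc x y z h h' := C.mul_assoc i x y z h h'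
  l_hid x := C.face_eps_self _ _ x
  r_hid x := C.face_eps_self _ _ x
  b_hid x := C.face_eps_gt i i _ x le_rfl
  t_hid x := C.face_eps_gt i i _ x le_rfl
  l_vid x := C.face_eps_lt i i _ x le_rfl
  r_vid x := C.face_eps_lt i i _ x le_rfl
  b_vid x := C.face_eps_self _ _ x
  t_vid x := C.face_eps_self _ _ x
  l_cp x := C.face_conn_opp i Side.minus x
  r_cp x := C.face_conn_same i Side.plus x
  b_cp x := C.face_succ_conn_opp i Side.minus x
  t_cp x := C.face_succ_conn_same i Side.plus x
  l_cm x := C.face_conn_same i Side.minus x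
  r_cm x := C.face_conn_opp i Side.plus x
  b_cm x := C.face_succ_conn_same i Side.minus x
  t_cm x := C.face_succ_conn_opp i Side.plus x
  l_hm A B h := C.face_minus_mul _ A B h
  r_hm A B h := C.face_plus_mul _ A B h
  b_hm A B h := by
    rw [C.face_mul _ _ (Fin.castSucc_lt_succ).ne' _ _ _ h, lowerIndex_succ_self]
  t_hm A B h := by
    rw [C.face_mul _ _ (Fin.castSucc_lt_succ).ne' _ _ _ h, lowerIndex_succ_self]
  l_vm A B h := by
    rw [C.face_mul _ _ (Fin.castSucc_lt_succ).ne _ _ _ h, lowerIndex_castSucc_self]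
  r_vm A B h := by
    rw [C.face_mul _ _ (Fin.castSucc_lt_succ).ne _ _ _ h, lowerIndex_castSucc_self]
  b_vm A B h := C.face_minus_mul _ A B h
  t_vm A B h := C.face_plus_mul _ A B h
  exchange A B X Y h₁ h₂ h₃ h₄ :=
    C.mul_exchange _ _ (Fin.castSucc_lt_succ).ne' A X B Y h₃ h₄ h₁ h₂
  hm_assoc A B X h h' := C.mul_assoc _ A B X h h'
  vm_assoc A B X h h' := C.mul_assoc _ A B X h h'
  hid_hm A x h := C.eps_mul _ A x h
  hm_hid A x h := C.mul_eps _ A x h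
  vid_vm A x h := C.eps_mul _ A x h
  vm_vid A x h := C.mul_eps _ A x h
  hid_one p := C.eps_eps i i p le_rfl
  cp_one p := (C.conn_eps_self i _ p).trans (C.eps_eps i i p le_rfl)
  cm_one p := (C.conn_eps_self i _ p).trans (C.eps_eps i i p le_rfl)
  hid_mul x y h := by
    have e := lowerIndex_castSucc_self i
    have := C.eps_map_mul i.castSucc i.succ (Fin.castSucc_lt_succ).ne x y (by rw [e]; exact h)
    rwa [e] at this
  vid_mul x y h := by
    have e := lowerIndex_succ_self i
    have := C.eps_map_mul i.succ i.castSucc (Fin.castSucc_lt_succ).ne' x y (by rw [e]; exact h)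
    rwa [e] at this
  cp_hm_cm x := by
    rw [mul_eq_comp _ _ _
      ((C.face_conn_same i Side.plus x).trans (C.face_conn_same i Side.minus x).symm),
      C.conn_comp_conn]
  cp_vm_cm x := by
    rw [mul_eq_comp _ _ _
      ((C.face_succ_conn_same i Side.plus x).trans (C.face_succ_conn_same i Side.minus x).symm),
      C.conn_comp_succ_conn]
  cm_mul x y h := by
    have h₁ : C.face i.castSucc Side.plus (C.conn i Side.minus x) =
        C.face i.castSucc Side.minus (C.eps i.succ y) := by
      rw [C.face_eps_lt i i _ _ le_rfl, ← h]
      exact C.face_conn_opp i Side.plus x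
    have h₂ : C.face i.castSucc Side.plus (C.eps i.castSucc y) =
        C.face i.castSucc Side.minus (C.conn i Side.minus y) := by
      rw [C.face_eps_self, C.face_conn_same]
    -- One of the four blocks in the cubical transport law is an identity for composition in
    -- direction `i`; dropping it gives the three-block form required of a `ConnSquares`.
    have h₄ : C.mul i.castSucc (C.eps i.castSucc y) (C.conn i Side.minus y) =
        C.conn i Side.minus y := C.eps_mul _ _ _ (C.face_conn_same i Side.minus y).symm
    have h₃ : C.face i.succ Side.plus (C.mul i.castSucc (C.conn i Side.minus x) (C.eps i.succ y)) =
        C.face i.succ Side.minus (C.conn i Side.minus y) := by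
      rw [C.face_mul _ _ (Fin.castSucc_lt_succ).ne' _ _ _ h₁, lowerIndex_succ_self,
        C.face_eps_self, C.face_succ_conn_same,
        show C.face i.succ Side.plus (C.conn i Side.minus x) = _ from
          C.face_succ_conn_opp i Side.plus x,
        C.eps_mul _ _ _ h]
    rw [mul_eq_comp _ _ _ h, mul_eq_comp _ _ _ h₃, C.conn_minus_comp i x y h h₁ h₂]
    · exact C.comp_congr rfl (mul_eq_comp _ _ _ h₁).symm ((mul_eq_comp _ _ _ h₂).symm.trans h₄) _ _
    · rw [← mul_eq_comp, ← mul_eq_comp, h₄, h₃]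
  cp_mul x y h := by
    have h₁ : C.face i.castSucc Side.plus (C.conn i Side.plus x) =
        C.face i.castSucc Side.minus (C.eps i.castSucc x) := by
      rw [C.face_eps_self, C.face_conn_same]
    have h₂ : C.face i.castSucc Side.plus (C.eps i.succ x) =
        C.face i.castSucc Side.minus (C.conn i Side.plus y) := by
      rw [C.face_eps_lt i i _ _ le_rfl, h]
      exact (C.face_conn_opp i Side.minus y).symm
    have h₄ : C.mul i.castSucc (C.conn i Side.plus x) (C.eps i.castSucc x) =
        C.conn i Side.plus x := C.mul_eps _ _ _ (C.face_conn_same i Side.plus x).symm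
    have h₃ : C.face i.succ Side.plus (C.conn i Side.plus x) =
        C.face i.succ Side.minus (C.mul i.castSucc (C.eps i.succ x) (C.conn i Side.plus y)) := by
      rw [C.face_mul _ _ (Fin.castSucc_lt_succ).ne' _ _ _ h₂, lowerIndex_succ_self,
        C.face_eps_self, C.face_succ_conn_same,
        show C.face i.succ Side.minus (C.conn i Side.plus y) = _ from
          C.face_succ_conn_opp i Side.minus y,
        C.mul_eps _ _ _ h.symm]
    rw [mul_eq_comp _ _ _ h, mul_eq_comp _ _ _ h₃, C.conn_plus_comp i x y h h₁ h₂]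
    · exact C.comp_congr rfl ((mul_eq_comp _ _ _ h₁).symm.trans h₄) (mul_eq_comp _ _ _ h₂).symm _ _
    · rw [← mul_eq_comp, ← mul_eq_comp, h₄, h₃]

end CubicalOmegaCategory

/-! ### One folding step in the cubical setting -/

namespace CubicalOmegaCategory

variable {C : CubicalOmegaCategory.{u}}

theorem squares_psi_eq {n : ℕ} (i : Fin (n + 1)) (A : C.cell (n + 2)) :
    (C.squares i).psi A = C.mul i.succ (C.mul i.succ
      (C.conn i Side.plus (C.face i.succ Side.minus A)) A)
      (C.conn i Side.minus (C.face i.succ Side.plus A)) := rfl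

theorem psi_eq_squares_psi {n : ℕ} (i : Fin (n + 1)) (A : C.cell (n + 2)) :
    C.psi i A = (C.squares i).psi A := by
  have h₁ : C.face i.succ Side.plus (C.conn i Side.plus (C.face i.succ Side.minus A)) =
    C.face i.succ Side.minus A := C.face_succ_conn_same i Side.plus _
  have h₂ : C.face i.succ Side.plus
      (C.mul i.succ (C.conn i Side.plus (C.face i.succ Side.minus A)) A) =
      C.face i.succ Side.minus (C.conn i Side.minus (C.face i.succ Side.plus A)) := by
    rw [C.face_plus_mul _ _ _ h₁, C.face_succ_conn_same]
  rw [squares_psi_eq, mul_eq_comp _ _ _ h₂]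
  exact C.comp_congr rfl (mul_eq_comp _ _ _ h₁).symm rfl _ _

theorem squares_invE_iff {n : ℕ} {i : Fin (n + 1)} {x y : C.cell (n + 1)} :
    (C.squares i).InvE x y ↔ C.IsRInverse i x y :=
  ⟨fun h => isRInverse_iff.2 ⟨h.1, h.2.symm, h.3, h.4⟩, fun h =>
    have h := isRInverse_iff.1 h
    ⟨h.1, h.2.1.symm, h.2.2.1, h.2.2.2⟩⟩

theorem squares_invH_iff {n : ℕ} {i : Fin (n + 1)} {A B : C.cell (n + 2)} :
    (C.squares i).InvH A B ↔ C.IsRInverse i.castSucc A B :=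
  ⟨fun h => isRInverse_iff.2 ⟨h.1, h.2.symm, h.3, h.4⟩, fun h =>
    have h := isRInverse_iff.1 h
    ⟨h.1, h.2.1.symm, h.2.2.1, h.2.2.2⟩⟩

theorem squares_invV_iff {n : ℕ} {i : Fin (n + 1)} {A B : C.cell (n + 2)} :
    (C.squares i).InvV A B ↔ C.IsRInverse i.succ A B :=
  ⟨fun h => isRInverse_iff.2 ⟨h.1, h.2.symm, h.3, h.4⟩, fun h =>
    have h := isRInverse_iff.1 h
    ⟨h.1, h.2.1.symm, h.2.2.1, h.2.2.2⟩⟩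

theorem psi_match_left {n : ℕ} (i : Fin (n + 1)) (A : C.cell (n + 2)) :
    C.face i.succ Side.plus (C.conn i Side.plus (C.face i.succ Side.minus A)) =
      C.face i.succ Side.minus A := C.face_succ_conn_same i Side.plus _

theorem psi_match_right {n : ℕ} (i : Fin (n + 1)) (A : C.cell (n + 2)) :
    C.face i.succ Side.plus
      (C.mul i.succ (C.conn i Side.plus (C.face i.succ Side.minus A)) A) =
      C.face i.succ Side.minus (C.conn i Side.minus (C.face i.succ Side.plus A)) := by
  rw [C.face_plus_mul _ _ _ (psi_match_left i A), C.face_succ_conn_same]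

theorem face_conn_face_match {n : ℕ} (i : Fin (n + 1)) (j : Fin (n + 2)) (hj : j ≠ i.castSucc)
    (hj' : j ≠ i.succ) {A B : C.cell (n + 2)} (h : C.face j Side.plus A = C.face j Side.minus B)
    (α β : Side) : C.face j Side.plus (C.conn i α (C.face i.succ β A)) =
      C.face j Side.minus (C.conn i α (C.face i.succ β B)) := by
  refine C.face_conn_congr i j hj hj' α _ _ ?_
  rw [lowerIndex_castSucc_eq_succ i hj hj']
  exact face_face_match hj'.symm β h

theorem face_psi_match {n : ℕ} (i : Fin (n + 1)) (j : Fin (n + 2)) (hj : j ≠ i.castSucc)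
    (hj' : j ≠ i.succ) {A B : C.cell (n + 2)} (h : C.face j Side.plus A = C.face j Side.minus B) :
    C.face j Side.plus (C.psi i A) = C.face j Side.minus (C.psi i B) := by
  simp only [psi_eq_squares_psi, squares_psi_eq]
  rw [C.face_mul _ _ hj' _ _ _ (psi_match_right i A), C.face_mul _ _ hj' _ _ _ (psi_match_left i A),
    C.face_mul _ _ hj' _ _ _ (psi_match_right i B), C.face_mul _ _ hj' _ _ _ (psi_match_left i B),
    h, face_conn_face_match i j hj hj' h, face_conn_face_match i j hj hj' h]

theorem psi_mul_of_ne {n : ℕ} (i : Fin (n + 1)) (j : Fin (n + 2)) (hj : j ≠ i.castSucc)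
    (hj' : j ≠ i.succ) (A B : C.cell (n + 2))
    (h : C.face j Side.plus A = C.face j Side.minus B) :
    C.psi i (C.mul j A B) = C.mul j (C.psi i A) (C.psi i B) := by
  have e := lowerIndex_castSucc_eq_succ i hj hj'
  have hf : ∀ α, C.face (lowerIndex i.castSucc j) Side.plus (C.face i.succ α A) =
      C.face (lowerIndex i.castSucc j) Side.minus (C.face i.succ α B) := by
    intro α
    rw [e]
    exact face_face_match hj'.symm α h
  have hc : ∀ α β, C.conn i α (C.face i.succ β (C.mul j A B)) =
      C.mul j (C.conn i α (C.face i.succ β A)) (C.conn i α (C.face i.succ β B)) := by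
    intro α β
    rw [C.face_mul _ _ hj'.symm _ _ _ h, ← e, C.conn_map_mul i j hj hj' _ _ _ (hf β)]
  have hm := face_conn_face_match i j hj hj' h
  simp only [psi_eq_squares_psi, squares_psi_eq, hc]
  rw [C.mul_exchange _ _ hj' _ _ _ _ (hm _ _) h (psi_match_left i A) (psi_match_left i B),
    C.mul_exchange _ _ hj' _ _ _ _ _ (hm _ _) (psi_match_right i A)
      (psi_match_right i B)]
  rw [C.face_mul _ _ hj' _ _ _ (psi_match_left i A),
    C.face_mul _ _ hj' _ _ _ (psi_match_left i B), hm, h]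

theorem IsRInverse.psi_of_ne {n : ℕ} {i : Fin (n + 1)} {j : Fin (n + 2)}
    (hj : j ≠ i.castSucc) (hj' : j ≠ i.succ) {A B : C.cell (n + 2)} (h : C.IsRInverse j A B) :
    C.IsRInverse j (C.psi i A) (C.psi i B) := by
  have e := lowerIndex_castSucc_eq_succ i hj hj'
  have hc : ∀ α β, C.IsRInverse j (C.conn i α (C.face i.succ β A))
      (C.conn i α (C.face i.succ β B)) :=
    fun α β => IsRInverse.conn hj hj' α (e ▸ h.face i.succ hj'.symm β)
  simp only [psi_eq_squares_psi, squares_psi_eq]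
  exact IsRInverse.mul hj'.symm (IsRInverse.mul hj'.symm (hc _ _) h (psi_match_left i A)) (hc _ _)
    (psi_match_right i A)

/-- The direction in which the folding along `i` of an `R_j`-invertible cell is invertible. -/
def foldDir {n : ℕ} (i : Fin (n + 1)) (j : Fin (n + 2)) : Fin (n + 2) :=
  if j = i.succ then i.castSucc else j

theorem foldDir_le {n : ℕ} (i : Fin (n + 1)) {j : Fin (n + 2)} (h : j.val ≤ i.val + 1) :
    (foldDir i j).val ≤ i.val := by
  unfold foldDir
  split_ifs with hj
  · simp
  · have : j.val ≠ i.val + 1 := fun e => hj (Fin.ext (by simpa using e))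
    omega

theorem IsRInvertible.psi {n : ℕ} (i : Fin (n + 1)) {j : Fin (n + 2)} {A : C.cell (n + 2)}
    (h : C.IsRInvertible j A) : C.IsRInvertible (foldDir i j) (C.psi i A) := by
  obtain ⟨B, h⟩ := h
  by_cases hj' : j = i.succ
  · subst hj'
    obtain ⟨Z, hZ⟩ := ConnSquares.InvV.psi (squares_invV_iff.2 h)
    rw [foldDir, if_pos rfl, psi_eq_squares_psi]
    exact ⟨Z, squares_invH_iff.1 hZ⟩
  rw [foldDir, if_neg hj']
  by_cases hj : j = i.castSucc
  · subst hj
    obtain ⟨Z, hZ⟩ := ConnSquares.InvH.psi (squares_invH_iff.2 h)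
    rw [psi_eq_squares_psi]
    exact ⟨Z, squares_invH_iff.1 hZ⟩
  · exact ⟨_, h.psi_of_ne hj hj'⟩

/-- A cell is `R_j`-invertible when its folding along `i` and its faces in the directions `i` and
`i + 1` are invertible. -/
theorem IsRInvertible.of_psi {n : ℕ} (i : Fin (n + 1)) {j : Fin (n + 2)} {A : C.cell (n + 2)}
    (h : C.IsRInvertible (foldDir i j) (C.psi i A))
    (h₁ : i.castSucc ≠ j → ∀ α,
      C.IsRInvertible (lowerIndex i.castSucc j) (C.face i.castSucc α A))
    (h₂ : i.succ ≠ j → ∀ α, C.IsRInvertible (lowerIndex i.succ j) (C.face i.succ α A)) :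
    C.IsRInvertible j A := by
  obtain ⟨Z, hZ⟩ := h
  by_cases hj' : j = i.succ
  · subst hj'
    have h₁ := h₁ (Fin.castSucc_lt_succ).ne
    rw [lowerIndex_castSucc_self] at h₁
    obtain ⟨x, hx⟩ := h₁ Side.minus
    obtain ⟨y, hy⟩ := h₁ Side.plus
    rw [foldDir, if_pos rfl, psi_eq_squares_psi] at hZ
    obtain ⟨B, -, hB⟩ := ConnSquares.InvV.of_psi (S := C.squares i) ConnSquares.closed_true
      (squares_invH_iff.2 hZ) trivial (squares_invE_iff.2 hx) (squares_invE_iff.2 hy)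
    exact ⟨B, squares_invV_iff.1 hB⟩
  rw [foldDir, if_neg hj'] at hZ
  have h₂ := h₂ (Ne.symm hj')
  by_cases hj : j = i.castSucc
  · subst hj
    rw [lowerIndex_succ_self] at h₂
    obtain ⟨x, hx⟩ := h₂ Side.minus
    obtain ⟨y, hy⟩ := h₂ Side.plus
    rw [psi_eq_squares_psi] at hZ
    obtain ⟨B, -, hB⟩ := ConnSquares.InvH.of_psi (S := C.squares i) ConnSquares.closed_true
      (squares_invH_iff.2 hZ) trivial (squares_invE_iff.2 hx) (squares_invE_iff.2 hy)
    exact ⟨B, squares_invH_iff.1 hB⟩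
  have h₁ := h₁ (Ne.symm hj)
  -- Here `j` is transverse to the square. Every factor of the unfolding formula is inverted in
  -- direction `j`, with the order of the factors unchanged; this uses faces in both directions `i`
  -- and `i + 1`.
  rw [← lowerIndex_castSucc_eq_succ i hj hj'] at h₂
  obtain ⟨a, ha⟩ := h₁ Side.minus
  obtain ⟨a', ha'⟩ := h₁ Side.plus
  obtain ⟨x, hx⟩ := h₂ Side.minus
  obtain ⟨y, hy⟩ := h₂ Side.plus
  rw [psi_eq_squares_psi] at hZ
  let S := C.squares i
  obtain ⟨m₁, m₂, m₃, m₄⟩ := S.unfold_psi_match A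
  have k := IsRInverse.mul (Ne.symm hj) (IsRInverse.mul (Ne.symm hj) (IsRInverse.mul (Ne.symm hj')
    (ha.eps (Ne.symm hj)) (hy.conn hj hj' Side.plus) m₁) hZ m₃) (IsRInverse.mul (Ne.symm hj')
    (hx.conn hj hj' Side.minus) (ha'.eps (Ne.symm hj)) m₂) m₄
  exact ⟨_, (S.unfold_psi A).subst (motive := fun X => C.IsRInverse j X _) k⟩

theorem IsRInvertible.mul {n : ℕ} {i k : Fin (n + 1)} (hik : i ≠ k) {A B : C.cell (n + 1)}
    (hA : C.IsRInvertible k A) (hB : C.IsRInvertible k B)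
    (h : C.face i Side.plus A = C.face i Side.minus B) : C.IsRInvertible k (C.mul i A B) := by
  obtain ⟨A', hA⟩ := hA
  obtain ⟨B', hB⟩ := hB
  exact ⟨_, hA.mul hik hB h⟩

theorem face_psi_of_lt {n : ℕ} (i : Fin (n + 1)) (k : Fin (n + 2)) (hk : k ≤ i.castSucc)
    (α : Side) (A : C.cell (n + 3)) :
    C.face k.castSucc α (C.psi i.succ A) = C.psi i (C.face k.castSucc α A) := by
  have hk' : k ≤ i.succ := hk.trans (Fin.castSucc_lt_succ).le
  have hne : k.castSucc ≠ i.succ.succ := by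
    have := Fin.le_def.1 hk
    simp only [ne_eq, Fin.ext_iff, Fin.val_castSucc, Fin.val_succ] at *
    omega
  simp only [psi_eq_squares_psi, squares_psi_eq]
  rw [C.face_mul _ _ hne _ _ _ (psi_match_right i.succ A),
    C.face_mul _ _ hne _ _ _ (psi_match_left i.succ A), C.face_conn_lt _ _ _ _ _ hk,
    C.face_conn_lt _ _ _ _ _ hk, lowerIndex_castSucc_succ hk', C.face_face _ _ _ _ _ hk',
    C.face_face _ _ _ _ _ hk']

/-! ### Invertible faces under folding -/

variable (C) in
/-- The faces of `A` in the directions `l ≤ k`, `l ≠ j`, are invertible in the direction `j`. -/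
def FacesInvertible {n : ℕ} (k : ℕ) (j : Fin (n + 2)) (A : C.cell (n + 2)) : Prop :=
  ∀ l, l ≠ j → l.val ≤ k → ∀ α, C.IsRInvertible (lowerIndex l j) (C.face l α A)

theorem FacesInvertible.psi {n : ℕ} (i : Fin (n + 1)) {j : Fin (n + 2)} {A : C.cell (n + 2)}
    (h : C.FacesInvertible (i.val + 1) j A) :
    C.FacesInvertible i.val (foldDir i j) (C.psi i A) := by
  intro l hl hli α
  rcases eq_or_ne l i.castSucc with rfl | hne
  · have hj' : j ≠ i.succ := by
      rintro rfl
      simp [foldDir] at hl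
    rw [foldDir, if_neg hj'] at hl ⊢
    have h₁ := h i.castSucc hl (by simp)
    have h₂ := h i.succ hj'.symm (by simp)
    rw [← lowerIndex_castSucc_eq_succ i hl.symm hj'] at h₂
    have hi : i ≠ lowerIndex i.castSucc j := by
      have := lowerIndex_ne (Fin.castSucc_lt_succ (i := i)).ne' hl.symm hj'.symm
      rwa [lowerIndex_castSucc_self] at this
    rw [psi_eq_squares_psi]
    let S := C.squares i
    cases α
    · have e : C.face i.castSucc Side.minus (S.psi A) =
        C.mul i (C.face i.castSucc Side.minus A) (C.face i.succ Side.plus A) := S.l_psi A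
      rw [e]
      exact (h₁ _).mul hi (h₂ _) (S.src_t A).symm
    · have e : C.face i.castSucc Side.plus (S.psi A) =
        C.mul i (C.face i.succ Side.minus A) (C.face i.castSucc Side.plus A) := S.r_psi A
      rw [e]
      exact (h₂ _).mul hi (h₁ _) (S.tgt_b A)
  · have hlt : l.val < i.val := lt_of_le_of_ne hli (by simpa [Fin.ext_iff] using hne)
    obtain _ | n := n
    · omega
    obtain ⟨i, rfl⟩ := Fin.eq_succ_of_ne_zero (Fin.ne_zero_of_lt (a := ⟨l.val, by omega⟩) (b := i)
      (Fin.lt_def.2 hlt))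
    obtain ⟨k, rfl⟩ := Fin.exists_castSucc_eq.2 (Fin.ne_last_of_lt (b := i.succ.succ) (a := l)
      (by simp [Fin.lt_def] at *; omega))
    have hk : k ≤ i.castSucc := by simp [Fin.le_def] at *; omega
    rw [C.face_psi_of_lt i k hk]
    have hkj : k.castSucc ≠ j := by
      rintro rfl
      apply hl
      rw [foldDir, if_neg]
      simp [Fin.ext_iff, Fin.le_def] at *
      omega
    -- Taking a face in a direction below `i` lowers the folding index by one; the change of
    -- direction commutes with this renumbering.
    have e : lowerIndex k.castSucc (foldDir i.succ j) = foldDir i (lowerIndex k.castSucc j) := by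
      by_cases hj : j = i.succ.succ
      · subst hj
        have hk' : k ≤ i.succ := hk.trans (Fin.castSucc_lt_succ).le
        rw [foldDir, foldDir, if_pos rfl, lowerIndex_castSucc_succ hk', if_pos rfl]
        simp only [lowerIndex, Fin.ext_iff, Fin.le_def, Fin.val_castSucc, Fin.val_succ] at *
        split_ifs <;> omega
      · rw [foldDir, foldDir, if_neg hj, if_neg]
        simp only [lowerIndex, Fin.ext_iff, Fin.le_def, Fin.val_castSucc, Fin.val_succ] at *
        split_ifs <;> omega
    rw [e]
    exact (h k.castSucc hkj (by omega) α).psi i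

/-! ### Iterated folding -/

variable (C) in
/-- The cell `ψ_1 ⋯ ψ_k A`. -/
def foldTo {m : ℕ} : ℕ → C.cell (m + 1) → C.cell (m + 1)
  | 0, A => A
  | k + 1, A => foldTo k (if h : k < m then C.psi ⟨k, h⟩ A else A)

theorem foldTo_succ {m : ℕ} (i : Fin m) (A : C.cell (m + 1)) :
    C.foldTo (i.val + 1) A = C.foldTo i.val (C.psi i A) := by
  simp [foldTo]

theorem psiAll_eq_foldTo {m : ℕ} (A : C.cell (m + 1)) : C.psiAll A = C.foldTo m A := by
  have key : ∀ (k : ℕ) (hk : k ≤ m) (A : C.cell (m + 1)),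
      Fin.foldr k (fun i B => C.psi (i.castLE hk) B) A = C.foldTo k A := by
    intro k
    induction k with
    | zero => intro _ _; simp [foldTo]
    | succ k ih =>
      intro hk A
      rw [Fin.foldr_succ_last, foldTo, dif_pos (show k < m by omega)]
      exact ih (by omega) _
  exact key m le_rfl A

theorem isRInvertible_foldTo {n : ℕ} (k : ℕ) (hk : k ≤ n + 1) {j : Fin (n + 2)}
    (hj : j.val ≤ k) {A : C.cell (n + 2)} (h : C.IsRInvertible j A) :
    C.IsRInvertible 0 (C.foldTo k A) := by
  induction k generalizing j A with
  | zero =>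
    obtain rfl : j = 0 := Fin.ext (by simpa using hj)
    exact h
  | succ k ih =>
    rw [foldTo_succ ⟨k, hk⟩]
    exact ih (by omega) (foldDir_le ⟨k, hk⟩ hj) (h.psi ⟨k, hk⟩)

/-- The induction must vary both `j` and `A`: undoing one folding requires invertibility of the
folded cell in its new direction, and that cell has one direction fewer in which its faces are
controlled. -/
theorem isRInvertible_of_foldTo {n : ℕ} (k : ℕ) (hk : k ≤ n + 1) {j : Fin (n + 2)}
    (hj : j.val ≤ k) {A : C.cell (n + 2)} (h : C.IsRInvertible 0 (C.foldTo k A))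
    (hf : C.FacesInvertible k j A) : C.IsRInvertible j A := by
  induction k generalizing j A with
  | zero =>
    obtain rfl : j = 0 := Fin.ext (by simpa using hj)
    exact h
  | succ k ih =>
    rw [foldTo_succ ⟨k, hk⟩] at h
    exact IsRInvertible.of_psi ⟨k, hk⟩ (ih (by omega) (foldDir_le ⟨k, hk⟩ hj) h (hf.psi ⟨k, hk⟩))
      (fun hne => hf _ hne (by simp)) (fun hne => hf _ hne (by simp))

/-! ### Thin cells -/

variable (C) in
/-- The cell `ψ_1 ⋯ ψ_k A` is in the image of `ε_1`. -/
def ThinTo {m : ℕ} (k : ℕ) (A : C.cell (m + 1)) : Prop :=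
  ∃ x : C.cell m, C.foldTo k A = C.eps 0 x

theorem thinTo_succ {n : ℕ} (i : Fin (n + 1)) {A : C.cell (n + 2)} :
    C.ThinTo (i.val + 1) A ↔ C.ThinTo i.val ((C.squares i).psi A) := by
  simp only [ThinTo, foldTo_succ, psi_eq_squares_psi]

/-- Each folding lowers the index of the degeneracy by one, until it is the first degeneracy. -/
theorem thinTo_eps {n : ℕ} (i : Fin (n + 2)) (x : C.cell (n + 1)) :
    C.ThinTo i.val (C.eps i x) := by
  induction i using Fin.induction with
  | zero => exact ⟨x, rfl⟩
  | succ i ih =>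
    rw [Fin.val_succ, thinTo_succ]
    exact (C.squares i).psi_vid x ▸ ih

/-- All directions `d` are treated together, since the folding of a composite along `i` or `i + 1`
involves composites in both of these directions. -/
theorem ThinTo.mul {n : ℕ} (k : ℕ) (hk : k ≤ n + 1) (d : Fin (n + 2)) {A B : C.cell (n + 2)}
    (h : C.face d Side.plus A = C.face d Side.minus B) (hA : C.ThinTo k A) (hB : C.ThinTo k B) :
    C.ThinTo k (C.mul d A B) := by
  induction k generalizing d A B with
  | zero =>
    obtain ⟨x, rfl : A = _⟩ := hA
    obtain ⟨y, rfl : B = _⟩ := hB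
    by_cases hd : 0 = d
    · subst hd
      -- Composability in the degenerate direction forces `x = y`.
      rw [C.mul_eps _ _ _ (by simpa [C.face_eps_self] using h.symm)]
      exact ⟨x, rfl⟩
    · refine ⟨_, (C.eps_map_mul 0 d hd x y ?_).symm⟩
      have := face_face_match hd Side.minus h
      simpa only [C.face_eps_self] using this
  | succ k ih =>
    let i : Fin (n + 1) := ⟨k, hk⟩
    let S := C.squares i
    have cl : ConnSquares.Closed (S := S) (fun A => C.ThinTo i.val (S.psi A)) :=
      ConnSquares.closed_comap_psi (S := S) (T := C.ThinTo i.val) (thinTo_eps i.castSucc)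
        (fun A B h => ih (by omega) i.castSucc h) (fun A B h => ih (by omega) i.succ h)
    have hA := (thinTo_succ i).1 hA
    have hB := (thinTo_succ i).1 hB
    refine (thinTo_succ i).2 ?_
    by_cases hd' : d = i.succ
    · subst hd'
      exact cl.vm A B h hA hB
    by_cases hd : d = i.castSucc
    · subst hd
      exact cl.hm A B h hA hB
    rw [← psi_eq_squares_psi] at hA hB ⊢
    rw [psi_mul_of_ne _ _ hd hd' _ _ h]
    exact ih (by omega) d (face_psi_match i d hd hd' h) hA hB

theorem closed_thinTo {n : ℕ} (i : Fin (n + 1)) :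
    ConnSquares.Closed (S := C.squares i) (C.ThinTo (m := n + 1) (i.val + 1)) := by
  have : C.ThinTo (m := n + 1) (i.val + 1) = fun A => C.ThinTo i.val ((C.squares i).psi A) :=
    funext fun A => propext (thinTo_succ i)
  rw [this]
  exact ConnSquares.closed_comap_psi (S := C.squares i) (T := C.ThinTo i.val)
    (thinTo_eps i.castSucc)
    (fun A B h => ThinTo.mul _ (by omega) i.castSucc h)
    (fun A B h => ThinTo.mul _ (by omega) i.succ h)

theorem ThinTo.of_isRInverse {n : ℕ} (k : ℕ) (hk : k ≤ n + 1) (j : Fin (n + 2))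
    {A B : C.cell (n + 2)} (hA : C.ThinTo k A) (h : C.IsRInverse j A B) : C.ThinTo k B := by
  induction k generalizing j A B with
  | zero =>
    obtain ⟨x, rfl : A = _⟩ := hA
    by_cases hj : 0 = j
    · subst hj
      exact ⟨x, h.unique (IsRInverse.of_eps 0 x)⟩
    · have := h.face 0 hj Side.minus
      rw [C.face_eps_self] at this
      exact ⟨_, h.unique (this.eps hj)⟩
  | succ k ih =>
    let i : Fin (n + 1) := ⟨k, hk⟩
    have hA' := (thinTo_succ i).1 hA
    -- The induction hypothesis makes `Z` thin at level `k`; since `Z` is its own folding, it is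
    -- thin at level `k + 1` too.
    have hZ : ∀ {Z}, (C.squares i).InvH ((C.squares i).psi A) Z → C.ThinTo (k + 1) Z := by
      intro Z hZ
      refine (thinTo_succ i).2 ?_
      rw [hZ.psi_eq_self]
      exact ih (by omega) _ hA' (squares_invH_iff.1 hZ)
    by_cases hj' : j = i.succ
    · subst hj'
      have h' := squares_invV_iff.2 h
      obtain ⟨Z, hZ'⟩ := h'.psi
      obtain ⟨B', hB', hAB'⟩ :=
        ConnSquares.InvV.of_psi (closed_thinTo i) hZ' (hZ hZ') h'.l h'.r
      rwa [h.unique (squares_invV_iff.1 hAB')]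
    by_cases hj : j = i.castSucc
    · subst hj
      have h' := squares_invH_iff.2 h
      obtain ⟨Z, hZ'⟩ := h'.psi
      obtain ⟨B', hB', hAB'⟩ :=
        ConnSquares.InvH.of_psi (closed_thinTo i) hZ' (hZ hZ') h'.b h'.t
      rwa [h.unique (squares_invH_iff.1 hAB')]
    · refine (thinTo_succ i).2 ?_
      have h' := h.psi_of_ne hj hj'
      rw [psi_eq_squares_psi, psi_eq_squares_psi] at h'
      exact ih (by omega) j hA' h'

/-! ### Invertible shells in terms of faces -/

theorem hasRInvertibleShell_iff {n : ℕ} (k : Fin (n + 2)) (A : C.cell (n + 2)) :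
    C.HasRInvertibleShell k A ↔
      ∀ l, l ≠ k → ∀ α, C.IsRInvertible (lowerIndex l k) (C.face l α A) := by
  constructor
  · rintro ⟨T, h₁, h₂, h₃, h₄⟩ l hl α
    have k₁ := congrFun (congrFun (congrArg CubicalSet.Shell.face h₃) l) α
    have k₂ := congrFun (congrFun (congrArg CubicalSet.Shell.face h₄) l) α
    simp only [shellComp, shellCompFace, dif_neg hl, CubicalSet.shellEps, CubicalSet.epsFace,
      if_neg hl, CubicalSet.shell] at k₁ k₂
    refine ⟨T.face l α, ?_, ?_, ?_, ?_⟩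
    · have := T.compat k l hl.symm Side.minus α
      rw [this, ← h₁]
      exact C.face_lower k l hl.symm _ _ A
    · have := T.compat k l hl.symm Side.plus α
      rw [this, h₂]
      exact (C.face_lower k l hl.symm _ _ A).symm
    · exact k₁.trans (congrArg _ (C.face_lower k l hl.symm _ _ A).symm)
    · exact k₂.trans (congrArg _ (C.face_lower k l hl.symm _ _ A).symm)
  · intro h
    have : Nonempty (C.cell (n + 1)) := ⟨C.face k Side.minus A⟩
    choose! F hF using h
    -- The candidate inverse shell swaps the two faces in direction `k` and uses the chosen inverses
    -- in all other directions.
    let G : Fin (n + 2) → Side → C.cell (n + 1) := fun l α =>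
      if l = k then C.face k α.opp A else F l α
    have hGk : ∀ α, G k α = C.face k α.opp A := fun α => if_pos rfl
    have hG : ∀ l, l ≠ k → ∀ α, G l α = F l α := fun l hl α => if_neg hl
    have key : ∀ l, l ≠ k → ∀ α β,
        C.face (lowerIndex l k) α (G l β) = C.face (lowerIndex k l) β (G k α) := by
      intro l hl α β
      obtain ⟨h₁, h₂, -, -⟩ := hF l hl β
      rw [hG l hl, hGk, C.face_lower l k hl]
      cases α
      · exact h₁.symm
      · exact h₂
    have hcompat : C.ShellCompat (n + 1) G := by
      intro a b hab α β
      by_cases ha : a = k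
      · subst ha; exact key b hab.symm α β
      by_cases hb : b = k
      · subst hb; exact (key a hab β α).symm
      rw [hG a ha, hG b hb]
      obtain _ | n := n
      · omega
      -- The two sides of the compatibility condition are inverses of the same iterated face of `A`.
      have i₁ := (hF b hb β).face (lowerIndex b a) (lowerIndex_ne hab (Ne.symm hb) ha) α
      have i₂ := (hF a ha α).face (lowerIndex a b) (lowerIndex_ne hab.symm (Ne.symm ha) hb) β
      rw [C.face_lower a b hab, lowerIndex_lowerIndex hab ha hb] at i₁
      exact i₁.unique i₂
    have hp : C.face k Side.plus A = G k Side.minus := (hGk Side.minus).symm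
    have hm : G k Side.plus = C.face k Side.minus A := hGk Side.plus
    refine ⟨⟨G, hcompat⟩, hp, hm, ?_, ?_⟩
    · ext l α
      by_cases hl : l = k
      · subst hl
        cases α <;> simp [shellComp, shellCompFace, CubicalSet.shellEps, CubicalSet.epsFace,
          CubicalSet.shell, hm]
      · obtain ⟨_, _, h₃, _⟩ := hF l hl α
        simp only [shellComp, shellCompFace, dif_neg hl, CubicalSet.shellEps,
          CubicalSet.epsFace, if_neg hl, CubicalSet.shell, hG l hl]
        rw [h₃, C.face_lower l k hl]
    · ext l α
      by_cases hl : l = k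
      · subst hl
        cases α <;> simp [shellComp, shellCompFace, CubicalSet.shellEps, CubicalSet.epsFace,
          CubicalSet.shell, ← hp]
      · obtain ⟨_, _, _, h₄⟩ := hF l hl α
        simp only [shellComp, shellCompFace, dif_neg hl, CubicalSet.shellEps,
          CubicalSet.epsFace, if_neg hl, CubicalSet.shell, hG l hl]
        rw [h₄, C.face_lower l k hl]

/-- A 1-cell has no other directions, so swapping its endpoints already gives an inverse shell. -/
theorem hasRInvertibleShell_zero (k : Fin 1) (A : C.cell 1) : C.HasRInvertibleShell k A := by
  refine ⟨⟨fun _ α => C.face k α.opp A, trivial⟩, rfl, rfl, ?_, ?_⟩ <;>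
  · ext l α
    cases α <;> rfl

end CubicalOmegaCategory

theorem proposition3p2p5 (C : CubicalOmegaCategory.{u}) {m : ℕ} (A : C.cell (m + 1))
    (j : Fin (m + 1)) :
    (C.IsRInvertible j A ↔ C.IsInvertible A ∧ C.HasRInvertibleShell j A) ∧
      (C.IsThin A → ∀ B : C.cell (m + 1), C.IsRInverse j A B → C.IsThin B) := by
  simp only [CubicalOmegaCategory.IsInvertible, CubicalOmegaCategory.IsThin,
    CubicalOmegaCategory.psiAll_eq_foldTo]
  obtain _ | n := m
  -- For 1-cells the iterated folding is empty.
  · obtain rfl : j = 0 := by omega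
    refine ⟨⟨fun h => ⟨h, CubicalOmegaCategory.hasRInvertibleShell_zero 0 A⟩, fun h => h.1⟩, ?_⟩
    rintro ⟨x, rfl : A = _⟩ B h
    exact ⟨x, h.unique (CubicalOmegaCategory.IsRInverse.of_eps 0 x)⟩
  · rw [CubicalOmegaCategory.hasRInvertibleShell_iff]
    refine ⟨⟨fun h => ⟨CubicalOmegaCategory.isRInvertible_foldTo _ le_rfl (by omega) h, ?_⟩,
      fun h => CubicalOmegaCategory.isRInvertible_of_foldTo _ le_rfl (by omega) h.1
        fun l hl _ => h.2 l hl⟩, fun hA B h => ?_⟩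
    · obtain ⟨B, h⟩ := h
      exact fun l hl α => ⟨_, h.face l hl α⟩
    · exact CubicalOmegaCategory.ThinTo.of_isRInverse _ le_rfl j hA h
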